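/- Let $n\ge 0$ and write $\mathbb T^n=(\mathbb R/\mathbb Z)^n$ with normalized Haar measure. For $w\in\mathbb T^n$, $m\in\mathbb Z^n$ and $g:\mathbb Z^n\to\mathbb C$ put $M_wT_mg(k)=e^{2\pi i w\cdot k}g(k-m)$ and $$V_gf(m,w)=\sum_{k\in\mathbb Z^n}f(k)\,\overline{M_wT_mg(k)} .$$ Fix a non-zero rapidly decreasing window $\varphi\in\mathcal S(\mathbb Z^n)$; $M^1(\mathbb Z^n)$ is the space of tempered distributions $f$ on $\mathbb Z^n$ (sequences of at most polynomial growth) with $V_\varphi f\in L^1(\mathbb Z^n\times\mathbb T^n)$. Let $\mathcal S(\mathbb Z^n\times\mathbb T^n)$ be the space of functions that are smooth on $\mathbb T^n$ and, with all their torus derivatives, rapidly decreasing in the $\mathbb Z^n$-variable uniformly on $\mathbb T^n$. Fix a non-zero window $\Phi\in\mathcal S(\mathbb Z^n\times\mathbb T^n)$; for $1\le p\le\infty$, $M^p(\mathbb Z^n\times\mathbb T^n)$ is the space of $\sigma\in\mathcal S'(\mathbb Z^n\times\mathbb T^n)$ whose short-time Fourier transform $V_\Phi\sigma(z,\zeta)=\langle\sigma,M_\zeta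 T_z\Phi\rangle$ lies in $L^p\big((\mathbb Z^n\times\mathbb T^n)\times(\mathbb T^n\times\mathbb Z^n)\big)$, with norm $\|V_\Phi\sigma\|_{L^p}$. For a function $u\in M^1\cap M^\infty$ (which is in particular integrable) and $g_1,g_2\in M^1(\mathbb Z^n)$, the localization operator on $\ell^2(\mathbb Z^n)$ is $$\mathfrak L^{g_1,g_2}_{u}f(k)=\sum_{m\in\mathbb Z^n}\int_{\mathbb T^n}u(m,w)\,V_{g_1}f(m,w)\,M_wT_mg_2(k)\,dw,\qquad k\in\mathbb Z^n .$$ For $\sigma\in M^p(\mathbb Z^n\times\mathbb T^n)$, $1\le p<\infty$, the operator $\mathfrak L^{g_1,g_2}_\sigma$ is defined by continuous extension: it is the limit in $\mathcal B(\ell^2(\mathbb Z^n))$ of $\mathfrak L^{g_1,g_2}_{u_i}$ for every sequence of functions $u_i\in M^1\cap M^\infty$ with $u_i\to\sigma$ in $M^p$. **Theorem.** Let $1\le p<\infty$, $\sigma\in M^p(\mathbb Z^n\times\mathbb T^n)$ and $g_1,g_2\in M^1(\mathbb Z^n)$. Then $\mathfrak L^{g_1,g_2}_\sigma$ is well defined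 by the above (approximating sequences exist, the operators $\mathfrak L^{g_1,g_2}_{u_i}$ are bounded, and they converge in operator norm to a limit that does not depend on the sequence), and $\mathfrak L^{g_1,g_2}_\sigma:\ell^2(\mathbb Z^n)\to\ell^2(\mathbb Z^n)$ is compact. If moreover $\sigma\in M^1(\mathbb Z^n\times\mathbb T^n)$, then $\mathfrak L^{g_1,g_2}_\sigma$ is of trace class, that is, compact with summable singular values (the eigenvalues of $|\mathfrak L^{g_1,g_2}_\sigma|$ counted with multiplicity). -/

import Mathlib

open scoped ContDiff
open MeasureTheory

namespace DiscreteLoc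

noncomputable section

/-! ### The groups `ℤⁿ`, `𝕋ⁿ`, their Haar measures and characters -/

/-- The lattice `ℤⁿ`. -/
abbrev Zn (n : ℕ) : Type := Fin n → ℤ

/-- The torus `𝕋ⁿ = (ℝ/ℤ)ⁿ`. -/
abbrev Tn (n : ℕ) : Type := UnitAddTorus (Fin n)

/-- Normalized Haar measure on `𝕋ⁿ`. -/
def haarT (n : ℕ) : Measure (Tn n) := Measure.pi fun _ => AddCircle.haarAddCircle

/-- Counting measure times normalized Haar measure on `ℤⁿ × 𝕋ⁿ`. -/
def haarZT (n : ℕ) : Measure (Zn n × Tn n) := Measure.count.prod (haarT n)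

/-- Haar measure on the phase space of `ℤⁿ × 𝕋ⁿ`, i.e. on `(ℤⁿ × 𝕋ⁿ) × (𝕋ⁿ × ℤⁿ)`, where
`𝕋ⁿ × ℤⁿ` is the dual group of `ℤⁿ × 𝕋ⁿ`. -/
def haarPhase (n : ℕ) : Measure ((Zn n × Tn n) × (Tn n × Zn n)) :=
  (haarZT n).prod ((haarT n).prod Measure.count)

/-- The character `e^{2πi w·k}`, for `k ∈ ℤⁿ` and `w ∈ 𝕋ⁿ`. -/
def chr {n : ℕ} (k : Zn n) (w : Tn n) : ℂ := UnitAddTorus.mFourier k w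

/-! ### Modulation spaces on `ℤⁿ` -/

/-- The Schwartz space `𝓢(ℤⁿ)`: rapidly decreasing sequences. -/
def IsSchwartzZ {n : ℕ} (g : Zn n → ℂ) : Prop :=
  ∀ M : ℕ, ∃ C : ℝ, ∀ k, (1 + ‖k‖) ^ M * ‖g k‖ ≤ C

/-- The tempered distributions on `ℤⁿ`, identified in the usual way with the sequences of at most
polynomial growth: `f` acts on `𝓢(ℤⁿ)` by `φ ↦ ∑ₖ f(k) φ(k)`. -/
def IsTemperedZ {n : ℕ} (f : Zn n → ℂ) : Prop :=
  ∃ (M : ℕ) (C : ℝ), ∀ k, ‖f k‖ ≤ C * (1 + ‖k‖) ^ M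

/-- The time-frequency shift `M_w T_m g` on `ℤⁿ`. -/
def shiftZ {n : ℕ} (m : Zn n) (w : Tn n) (g : Zn n → ℂ) : Zn n → ℂ :=
  fun k => chr k w * g (k - m)

/-- The short-time Fourier transform `V_g f (m, w) = ∑ₖ f(k) conj (M_w T_m g (k))` on `ℤⁿ`. -/
def stftZ {n : ℕ} (g f : Zn n → ℂ) (z : Zn n × Tn n) : ℂ :=
  ∑' k, f k * starRingEnd ℂ (shiftZ z.1 z.2 g k)

/-- `f ∈ M^p(ℤⁿ)`, where `φ` is the window used to define the modulation space. -/
def MemModulationZ {n : ℕ} (φ : Zn n → ℂ) (p : ENNReal) (f : Zn n → ℂ) : Prop :=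
  IsTemperedZ f ∧ MemLp (stftZ φ f) p (haarZT n)

/-! ### Schwartz functions and tempered distributions on `ℤⁿ × 𝕋ⁿ` -/

/-- The `ℤⁿ`-periodic function on `ℝⁿ` given by `φ(m, ·)`. -/
def lift {n : ℕ} (φ : Zn n × Tn n → ℂ) (m : Zn n) : (Fin n → ℝ) → ℂ :=
  fun x => φ (m, fun i => (x i : UnitAddCircle))

/-- The Schwartz space `𝓢(ℤⁿ × 𝕋ⁿ)`: the functions that are smooth on `𝕋ⁿ` and all of whose
derivatives in the torus variable decrease rapidly in `m ∈ ℤⁿ`, uniformly on `𝕋ⁿ`. -/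
def SchwartzZT (n : ℕ) : Submodule ℂ (Zn n × Tn n → ℂ) where
  carrier := {φ | (∀ m, ContDiff ℝ ∞ (lift φ m)) ∧
    ∀ M j : ℕ, ∃ C : ℝ, ∀ m x, (1 + ‖m‖) ^ M * ‖iteratedFDeriv ℝ j (lift φ m) x‖ ≤ C}
  zero_mem' := by
    have h0 : ∀ m : Zn n, lift (0 : Zn n × Tn n → ℂ) m = fun _ => 0 := fun m => rfl
    refine ⟨fun m => ?_, fun M j => ⟨0, fun m x => ?_⟩⟩
    · rw [h0]; exact contDiff_const
    · rw [h0]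
      have : iteratedFDeriv ℝ j (fun _ : Fin n → ℝ => (0 : ℂ)) = 0 := iteratedFDeriv_fun_zero
      simp [this]
  add_mem' := by
    rintro φ ψ ⟨hφ, hφ'⟩ ⟨hψ, hψ'⟩
    have h0 : ∀ m : Zn n, lift (φ + ψ) m = lift φ m + lift ψ m := fun m => rfl
    refine ⟨fun m => ?_, fun M j => ?_⟩
    · rw [h0]; exact (hφ m).add (hψ m)
    · obtain ⟨C, hC⟩ := hφ' M j
      obtain ⟨D, hD⟩ := hψ' M j
      refine ⟨C + D, fun m x => ?_⟩
      have hj : ((j : ℕ∞) : WithTop ℕ∞) ≤ ∞ := by exact_mod_cast le_top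
      rw [h0, iteratedFDeriv_add_apply ((hφ m).of_le hj).contDiffAt
        ((hψ m).of_le hj).contDiffAt]
      have hp : 0 ≤ (1 + ‖m‖) ^ M := by positivity
      calc _ ≤ (1 + ‖m‖) ^ M * (‖iteratedFDeriv ℝ j (lift φ m) x‖
              + ‖iteratedFDeriv ℝ j (lift ψ m) x‖) :=
            mul_le_mul_of_nonneg_left (norm_add_le _ _) hp
        _ ≤ C + D := by rw [mul_add]; exact add_le_add (hC m x) (hD m x)
  smul_mem' := by
    rintro c φ ⟨hφ, hφ'⟩
    have h0 : ∀ m : Zn n, lift (c • φ) m = c • lift φ m := fun m => rfl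
    refine ⟨fun m => ?_, fun M j => ?_⟩
    · rw [h0]; exact (hφ m).const_smul c
    · obtain ⟨C, hC⟩ := hφ' M j
      refine ⟨‖c‖ * C, fun m x => ?_⟩
      have hj : ((j : ℕ∞) : WithTop ℕ∞) ≤ ∞ := by exact_mod_cast le_top
      rw [h0, iteratedFDeriv_const_smul_apply ((hφ m).of_le hj).contDiffAt, norm_smul]
      calc _ = ‖c‖ * ((1 + ‖m‖) ^ M * ‖iteratedFDeriv ℝ j (lift φ m) x‖) := by ring
        _ ≤ ‖c‖ * C := mul_le_mul_of_nonneg_left (hC m x) (norm_nonneg c)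

/-- Complex conjugation on `𝓢(ℤⁿ × 𝕋ⁿ)`. -/
def conjZT {n : ℕ} (φ : SchwartzZT n) : SchwartzZT n :=
  ⟨fun z => starRingEnd ℂ (φ.1 z), by
    obtain ⟨φ, hφ, hφ'⟩ := φ
    have h0 : ∀ m : Zn n, lift (fun z => starRingEnd ℂ (φ z)) m
        = Complex.conjLIE ∘ lift φ m := fun m => rfl
    refine ⟨fun m => ?_, fun M j => ?_⟩
    · rw [h0]; exact Complex.conjLIE.contDiff.comp (hφ m)
    · obtain ⟨C, hC⟩ := hφ' M j
      refine ⟨C, fun m x => ?_⟩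
      rw [h0, LinearIsometryEquiv.norm_iteratedFDeriv_comp_left]
      exact hC m x⟩

theorem norm_chr {n : ℕ} (k : Zn n) (w : Tn n) : ‖chr k w‖ = 1 := by
  simp only [chr, UnitAddTorus.mFourier, ContinuousMap.coe_mk, norm_prod, fourier_apply,
    Circle.norm_coe, Finset.prod_const_one]

theorem chr_add {n : ℕ} (k : Zn n) (v w : Tn n) : chr k (v + w) = chr k v * chr k w := by
  simp only [chr, UnitAddTorus.mFourier, ContinuousMap.coe_mk, fourier_apply, Pi.add_apply,
    smul_add, AddCircle.toCircle_add, Circle.coe_mul, Finset.prod_mul_distrib]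

/-- A character of `𝕋ⁿ`, seen as a periodic function on `ℝⁿ`, is smooth. -/
theorem contDiff_chr {n : ℕ} (l : Zn n) :
    ContDiff ℝ ∞ (fun x : Fin n → ℝ => chr l fun i => (x i : UnitAddCircle)) := by
  have h : (fun x : Fin n → ℝ => chr l fun i => (x i : UnitAddCircle)) =
      fun x => ∏ i, Complex.exp (2 * Real.pi * Complex.I * l i * x i) := by
    funext x
    simp [chr, UnitAddTorus.mFourier]
  rw [h]
  refine contDiff_prod fun i _ => ?_
  refine ContDiff.cexp (contDiff_const.mul ?_)
  exact Complex.ofRealCLM.contDiff.comp (contDiff_apply ℝ ℝ i)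

/-- The derivatives of a character are bounded. -/
theorem norm_iteratedFDeriv_chr {n : ℕ} (l : Zn n) (j : ℕ) (x : Fin n → ℝ) :
    ‖iteratedFDeriv ℝ j (fun x : Fin n → ℝ => chr l fun i => (x i : UnitAddCircle)) x‖ =
      ‖iteratedFDeriv ℝ j (fun x : Fin n → ℝ => chr l fun i => (x i : UnitAddCircle)) 0‖ := by
  set E : (Fin n → ℝ) → ℂ := fun x => chr l fun i => (x i : UnitAddCircle) with hE
  have hadd : (fun y => E (y + x)) = E x • E := by
    funext y
    rw [Pi.smul_apply, smul_eq_mul, mul_comm]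
    exact chr_add l (fun i => (y i : UnitAddCircle)) (fun i => (x i : UnitAddCircle))
  have hnorm : ‖E x‖ = 1 := norm_chr l _
  have h1 := iteratedFDeriv_comp_add_right (𝕜 := ℝ) (f := E) j x 0
  have hj : ((j : ℕ∞) : WithTop ℕ∞) ≤ ∞ := by exact_mod_cast le_top
  rw [hadd, iteratedFDeriv_const_smul_apply ((contDiff_chr l).of_le hj).contDiffAt,
    zero_add] at h1
  rw [← h1, norm_smul, hnorm, one_mul]

/-- The translate `T_{(m, w)} φ (k, v) = φ(k - m, v - w)` on `𝓢(ℤⁿ × 𝕋ⁿ)`. -/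
def translateZT {n : ℕ} (z : Zn n × Tn n) (φ : SchwartzZT n) : SchwartzZT n :=
  ⟨fun y => φ.1 (y - z), by
    obtain ⟨φ, hφ, hφ'⟩ := φ
    obtain ⟨m, w⟩ := z
    have hr : ∀ i, ∃ r : ℝ, (r : UnitAddCircle) = w i := fun i =>
      QuotientAddGroup.mk_surjective (w i)
    choose r hr using hr
    have h0 : ∀ k : Zn n, lift (fun y => φ (y - (m, w))) k
        = fun x => lift φ (k - m) (x - r) := by
      intro k
      funext x
      simp only [lift, Prod.mk_sub_mk]
      congr 2
      funext i
      simp [hr]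
    refine ⟨fun k => ?_, fun M j => ?_⟩
    · rw [h0]; exact (hφ (k - m)).comp (contDiff_id.sub contDiff_const)
    · obtain ⟨C, hC⟩ := hφ' M j
      refine ⟨(1 + ‖m‖) ^ M * C, fun k x => ?_⟩
      rw [h0, iteratedFDeriv_comp_sub]
      have hk : 1 + ‖k‖ ≤ (1 + ‖m‖) * (1 + ‖k - m‖) := by
        have : ‖k‖ ≤ ‖k - m‖ + ‖m‖ := by simpa using norm_add_le (k - m) m
        nlinarith [norm_nonneg m, norm_nonneg (k - m)]
      calc _ ≤ ((1 + ‖m‖) * (1 + ‖k - m‖)) ^ M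
                * ‖iteratedFDeriv ℝ j (lift φ (k - m)) (x - r)‖ := by gcongr
        _ = (1 + ‖m‖) ^ M * ((1 + ‖k - m‖) ^ M
                * ‖iteratedFDeriv ℝ j (lift φ (k - m)) (x - r)‖) := by rw [mul_pow, mul_assoc]
        _ ≤ (1 + ‖m‖) ^ M * C := mul_le_mul_of_nonneg_left (hC _ _) (by positivity)⟩

/-- The modulation `M_{(x, l)} φ (k, v) = e^{2πi (x·k + l·v)} φ(k, v)` on `𝓢(ℤⁿ × 𝕋ⁿ)`. -/
def modulateZT {n : ℕ} (ζ : Tn n × Zn n) (φ : SchwartzZT n) : SchwartzZT n :=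
  ⟨fun y => chr y.1 ζ.1 * chr ζ.2 y.2 * φ.1 y, by
    obtain ⟨φ, hφ, hφ'⟩ := φ
    obtain ⟨a, l⟩ := ζ
    have h0 : ∀ k : Zn n, lift (fun y => chr y.1 a * chr l y.2 * φ y) k
        = chr k a • fun x => (chr l fun i => (x i : UnitAddCircle)) * lift φ k x := by
      intro k
      funext x
      simp [lift, mul_assoc]
    have hs : ∀ k : Zn n, ContDiff ℝ ∞
        (fun x => (chr l fun i => (x i : UnitAddCircle)) * lift φ k x) := fun k =>
      (contDiff_chr l).mul (hφ k)
    refine ⟨fun k => ?_, fun M j => ?_⟩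
    · rw [h0]; exact (hs k).const_smul (chr k a)
    · choose C hC using hφ' M
      set D : ℕ → ℝ := fun i => ‖iteratedFDeriv ℝ i
        (fun x : Fin n → ℝ => chr l fun i => (x i : UnitAddCircle)) 0‖ with hD
      refine ⟨∑ i ∈ Finset.range (j + 1), (j.choose i : ℝ) * D i * C (j - i), fun k x => ?_⟩
      have hj : ((j : ℕ∞) : WithTop ℕ∞) ≤ ∞ := by exact_mod_cast le_top
      have hn : ‖chr k a‖ = 1 := norm_chr k a
      simp only [h0]
      rw [iteratedFDeriv_const_smul_apply ((hs k).of_le hj).contDiffAt, norm_smul, hn, one_mul]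
      calc _ ≤ (1 + ‖k‖) ^ M * ∑ i ∈ Finset.range (j + 1), (j.choose i : ℝ)
              * ‖iteratedFDeriv ℝ i
                  (fun x : Fin n → ℝ => chr l fun i => (x i : UnitAddCircle)) x‖
              * ‖iteratedFDeriv ℝ (j - i) (lift φ k) x‖ :=
            mul_le_mul_of_nonneg_left
              (norm_iteratedFDeriv_mul_le (contDiff_chr l) (hφ k) x hj) (by positivity)
        _ = ∑ i ∈ Finset.range (j + 1), (j.choose i : ℝ) * D i
              * ((1 + ‖k‖) ^ M * ‖iteratedFDeriv ℝ (j - i) (lift φ k) x‖) := by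
            rw [Finset.mul_sum]
            refine Finset.sum_congr rfl fun i _ => ?_
            rw [norm_iteratedFDeriv_chr]
            ring
        _ ≤ _ := by
            refine Finset.sum_le_sum fun i _ => mul_le_mul_of_nonneg_left (hC _ _ _) ?_
            positivity⟩

/-- Continuity of a linear functional on `𝓢(ℤⁿ × 𝕋ⁿ)`, i.e. `σ ∈ 𝓢'(ℤⁿ × 𝕋ⁿ)`: the functional is
bounded by a constant times the maximum of finitely many of the seminorms
`sup_{m, x} (1 + |m|)^M |∂ʲφ(m, x)|`. -/
def IsTemperedZT {n : ℕ} (σ : SchwartzZT n →ₗ[ℂ] ℂ) : Prop :=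
  ∃ (N : ℕ) (C : ℝ), ∀ (φ : SchwartzZT n) (b : ℝ),
    (∀ M ≤ N, ∀ j ≤ N, ∀ m x, (1 + ‖m‖) ^ M * ‖iteratedFDeriv ℝ j (lift φ.1 m) x‖ ≤ b) →
      ‖σ φ‖ ≤ C * b

/-! ### Modulation spaces on `ℤⁿ × 𝕋ⁿ` -/

/-- The short-time Fourier transform `V_Φ σ (z, ζ) = ⟨σ, M_ζ T_z Φ⟩` of a distribution on
`ℤⁿ × 𝕋ⁿ`, where `⟨σ, ψ⟩ = σ(conj ψ)`, `z ∈ ℤⁿ × 𝕋ⁿ` and `ζ ∈ 𝕋ⁿ × ℤⁿ`. -/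
def stftZT {n : ℕ} (Φ : SchwartzZT n) (σ : SchwartzZT n →ₗ[ℂ] ℂ)
    (q : (Zn n × Tn n) × (Tn n × Zn n)) : ℂ :=
  σ (conjZT (modulateZT q.2 (translateZT q.1 Φ)))

/-- `σ ∈ M^p(ℤⁿ × 𝕋ⁿ)`, where `Φ` is the window used to define the modulation space. -/
def MemModulationZT {n : ℕ} (Φ : SchwartzZT n) (p : ENNReal) (σ : SchwartzZT n →ₗ[ℂ] ℂ) : Prop :=
  IsTemperedZT σ ∧ MemLp (stftZT Φ σ) p (haarPhase n)

/-- The norm of `M^p(ℤⁿ × 𝕋ⁿ)`. -/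
def modulationNormZT {n : ℕ} (Φ : SchwartzZT n) (p : ENNReal) (σ : SchwartzZT n →ₗ[ℂ] ℂ) : ENNReal :=
  eLpNorm (stftZT Φ σ) p (haarPhase n)

/-- The distribution `τ` is the integrable function `u`. -/
def IsRegular {n : ℕ} (τ : SchwartzZT n →ₗ[ℂ] ℂ) (u : Zn n × Tn n → ℂ) : Prop :=
  Integrable u (haarZT n) ∧ ∀ φ : SchwartzZT n, τ φ = ∫ z, u z * φ.1 z ∂haarZT n

/-! ### Localization operators -/

/-- The Hilbert space `ℓ²(ℤⁿ)`. -/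
abbrev ell2 (n : ℕ) : Type := lp (fun _ : Zn n => ℂ) 2

/-- `A` is the localization operator whose symbol is the function `u` and whose windows are
`g₁, g₂`: for all `f ∈ ℓ²(ℤⁿ)` and `k ∈ ℤⁿ`,
`A f (k) = ∑ₘ ∫ u(m, w) V_{g₁} f (m, w) M_w T_m g₂ (k) dw`. -/
def IsLocOpFun {n : ℕ} (g₁ g₂ : Zn n → ℂ) (u : Zn n × Tn n → ℂ) (A : ell2 n →L[ℂ] ell2 n) :
    Prop :=
  ∀ (f : ell2 n) (k : Zn n),
    (A f) k = ∑' m, ∫ w, u (m, w) * stftZ g₁ f (m, w) * shiftZ m w g₂ k ∂haarT n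

/-- `(uᵢ)` is a sequence of functions in `M^1 ∩ M^∞` that converges to `σ` in `M^p`. -/
def Approximates {n : ℕ} (Φ : SchwartzZT n) (p : ENNReal) (u : ℕ → Zn n × Tn n → ℂ)
    (σ : SchwartzZT n →ₗ[ℂ] ℂ) : Prop :=
  ∃ τ : ℕ → SchwartzZT n →ₗ[ℂ] ℂ,
    (∀ i, IsRegular (τ i) (u i) ∧ MemModulationZT Φ 1 (τ i) ∧ MemModulationZT Φ ⊤ (τ i)) ∧
    Filter.Tendsto (fun i => modulationNormZT Φ p (τ i - σ)) Filter.atTop (nhds 0)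

/-- `A` is the localization operator with symbol `σ ∈ M^p(ℤⁿ × 𝕋ⁿ)` and windows `g₁, g₂`, defined
by continuous extension from symbols that are functions in `M^1 ∩ M^∞`: there are such functions
that converge to `σ` in `M^p`, and for every such sequence the localization operators are bounded
and converge to `A` in operator norm. -/
def IsLocOp {n : ℕ} (Φ : SchwartzZT n) (p : ENNReal) (g₁ g₂ : Zn n → ℂ)
    (σ : SchwartzZT n →ₗ[ℂ] ℂ) (A : ell2 n →L[ℂ] ell2 n) : Prop :=
  (∃ u, Approximates Φ p u σ) ∧
    ∀ u, Approximates Φ p u σ → ∃ B : ℕ → ell2 n →L[ℂ] ell2 n,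
      (∀ i, IsLocOpFun g₁ g₂ (u i) (B i)) ∧ Filter.Tendsto B Filter.atTop (nhds A)

/-- The sum of the singular values of `A`, i.e. of the nonzero eigenvalues of `|A| = √(A* A)`,
counted with multiplicity. -/
def singularValueSum {H : Type*} [NormedAddCommGroup H] [InnerProductSpace ℂ H] [CompleteSpace H]
    (A : H →L[ℂ] H) : ENNReal :=
  ∑' s : {s : ℝ // 0 < s},
    (Module.finrank ℂ (Module.End.eigenspace ((CFC.abs A : H →L[ℂ] H) : H →ₗ[ℂ] H)
      ((s : ℝ) : ℂ)) : ENNReal) * ENNReal.ofReal s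

/-- The trace class `S₁`: the compact operators whose singular values are summable. -/
def IsTraceClass {H : Type*} [NormedAddCommGroup H] [InnerProductSpace ℂ H] [CompleteSpace H]
    (A : H →L[ℂ] H) : Prop :=
  IsCompactOperator A ∧ singularValueSum A < ⊤

end

end DiscreteLoc

open DiscreteLoc

open scoped ContDiff
open MeasureTheory
open DiscreteLoc

namespace DiscreteLoc

noncomputable section

/-! ### Trace class operators -/

section TraceClass

open InnerProductSpace

variable {H : Type*} [NormedAddCommGroup H] [InnerProductSpace ℂ H]

/-! Everything is read off from the Fourier coefficients `c(m, j)` of the symbol in its torus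
variable (`coeffZT`). Expanding the short-time Fourier transform and integrating over the torus
turns the localization operator into `A f(k) = ∑_{s,t} g₂(s) conj(g₁(t)) c(k - s, t - s) f(k - s +
t)`, a superposition of weighted shifts, each of norm at most `‖c‖_∞` (`isLocOpFun_coeffLocOp`).
Windows in `M¹(ℤⁿ)` lie in `ℓ¹` (`summable_of_memModulationZ`), so the superposition converges in
norm and `‖A‖ ≤ ‖g₁‖₁ ‖g₂‖₁ ‖c‖_∞`.

For finite `p`, the `Mᵖ` norm of the symbol is equivalent to the `ℓᵖ` norm of `c`. Indeed `V_Φ σ`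
is, on each torus fibre of phase space, a Fourier series with coefficients `conj(a(q)) c(q + (m,
l))`, where `a` is the summable coefficient family of `Φ`. Minkowski's inequality gives the upper
bound (`IsPhaseSeries.eLpNorm_le`), and a single coefficient with `a(r) ≠ 0` gives the lower one
(`IsPhaseSeries.eLpNorm_coeff_le`). Since `ℓᵖ ⊆ ℓ^∞`, convergence of symbols in `Mᵖ` forces norm
convergence of operators to a limit depending only on `c`.

If `c` is summable, each weighted shift is a sum of rank-one operators between unit vectors, and the
whole operator is a nuclear series (`isTraceClass_coeffLocOp`); this covers `σ ∈ M¹`. For general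
finite `p`, truncating `c` to finite sets converges in `ℓᵖ`, so the operator is a norm limit of
trace class operators, hence compact. -/

theorem isCompactOperator_rankOne (x y : H) : IsCompactOperator (rankOne ℂ x y) := by
  rw [rankOne_def']
  exact (isCompactOperator_of_locallyCompactSpace_rng
    (ContinuousLinearMap.toSpanSingleton ℂ x)).comp_clm (innerSL ℂ y)

theorem isCompactOperator_of_hasSum [CompleteSpace H] {ι : Type*} {F : ι → H →L[ℂ] H}
    {A : H →L[ℂ] H} (hF : ∀ i, IsCompactOperator (F i)) (hA : HasSum F A) :
    IsCompactOperator A := by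
  refine isCompactOperator_of_tendsto hA (Filter.Eventually.of_forall fun s => ?_)
  exact (compactOperator (RingHom.id ℂ) H H).sum_mem fun i _ => hF i

/-- No finiteness assumption is needed: `finrank` is `0` in infinite dimension and the family is
then empty. This matches `singularValueSum`, which counts multiplicities by `finrank`. -/
theorem exists_orthonormal_finrank (E : Submodule ℂ H) :
    ∃ b : Fin (Module.finrank ℂ E) → E, Orthonormal ℂ b := by
  rcases Nat.eq_zero_or_pos (Module.finrank ℂ E) with h | h
  · have : IsEmpty (Fin (Module.finrank ℂ E)) := by rw [h]; infer_instance
    exact ⟨fun i => isEmptyElim i, fun i => isEmptyElim i, fun i => isEmptyElim i⟩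
  · have := Module.finite_of_finrank_pos h
    exact ⟨stdOrthonormalBasis ℂ E, (stdOrthonormalBasis ℂ E).orthonormal⟩

/-- The nuclear pairing of an operator with two finite orthonormal families. -/
theorem norm_sum_inner_le_of_hasSum_rankOne {ι : Type*} {x y : ι → H} {A : H →L[ℂ] H}
    (hA : HasSum (fun i => rankOne ℂ (x i) (y i)) A)
    (hs : Summable fun i => ‖x i‖ * ‖y i‖) {α : Type*} [Fintype α] {u v : α → H}
    (hu : Orthonormal ℂ u) (hv : Orthonormal ℂ v) :
    ‖∑ a, inner ℂ (u a) (A (v a))‖ ≤ ∑' i, ‖x i‖ * ‖y i‖ := by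
  have h1 : ∀ a, HasSum (fun i => inner ℂ (u a) (rankOne ℂ (x i) (y i) (v a)))
      (inner ℂ (u a) (A (v a))) := fun a => by
    have := hA.mapL (((innerSL ℂ (u a)).comp
      (ContinuousLinearMap.apply ℂ H (v a))))
    simpa using! this
  have h2 := hasSum_sum (s := Finset.univ) fun a _ => h1 a
  refine h2.norm_le_of_bounded hs.hasSum fun i => ?_
  calc ‖∑ a, inner ℂ (u a) (rankOne ℂ (x i) (y i) (v a))‖
      ≤ ∑ a, ‖inner ℂ (u a) (x i)‖ * ‖inner ℂ (v a) (y i)‖ := by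
        refine (norm_sum_le _ _).trans (Finset.sum_le_sum fun a _ => le_of_eq ?_)
        rw [rankOne_apply, inner_smul_right, norm_mul, mul_comm, norm_inner_symm (y i)]
    -- Cauchy–Schwarz in `a`, then Bessel's inequality for each of the two orthonormal families.
    _ ≤ √(∑ a, ‖inner ℂ (u a) (x i)‖ ^ 2) * √(∑ a, ‖inner ℂ (v a) (y i)‖ ^ 2) :=
        Real.sum_mul_le_sqrt_mul_sqrt _ _ _
    _ ≤ ‖x i‖ * ‖y i‖ := by
        gcongr
        · exact Real.sqrt_le_left (norm_nonneg _) |>.2 (hu.sum_inner_products_le _)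
        · exact Real.sqrt_le_left (norm_nonneg _) |>.2 (hv.sum_inner_products_le _)

/-- This replaces the polar decomposition: `|A|² = A* A` gives `⟨A v_a, A v_b⟩ = s_b² ⟨v_a, v_b⟩`,
so only rescaling is left. -/
theorem orthonormal_inv_smul_apply_of_abs_eigenvector [CompleteSpace H] (A : H →L[ℂ] H)
    {α : Type*} {v : α → H} (hv : Orthonormal ℂ v) {s : α → ℝ} (hs : ∀ a, 0 < s a)
    (h : ∀ a, (CFC.abs A) (v a) = (s a : ℂ) • v a) :
    Orthonormal ℂ fun a => ((s a : ℂ)⁻¹) • A (v a) := by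
  classical
  rw [orthonormal_iff_ite] at hv ⊢
  intro a b
  have h1 : inner ℂ (A (v a)) (A (v b)) = (s b : ℂ) ^ 2 * inner ℂ (v a) (v b) := by
    have h2 : (star A * A) (v b) = (s b : ℂ) • (s b : ℂ) • v b := by
      rw [← CFC.abs_mul_abs, mul_apply_eq_comp, h, map_smul, h]
    rw [← ContinuousLinearMap.adjoint_inner_right, ← ContinuousLinearMap.star_eq_adjoint,
      ← mul_apply_eq_comp, h2, inner_smul_right, inner_smul_right]
    ring
  rw [inner_smul_left, inner_smul_right, h1, hv]
  have := (hs b).ne'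
  split_ifs with hab
  · subst hab
    have : (s a : ℂ) ≠ 0 := by exact_mod_cast this
    simp
    field_simp
  · simp

/-- The nuclear sum `∑ ‖x i‖ ‖y i‖` dominates the sum of the singular values. It suffices to treat
finitely many; with `v` an orthonormal family of eigenvectors of `|A|` and `u_a = A v_a / s_a`, each
singular value is `s_a = ⟨u_a, A v_a⟩`, and the nuclear pairing bounds the sum of these. -/
theorem isTraceClass_of_hasSum_rankOne [CompleteSpace H] {ι : Type*} {x y : ι → H}
    {A : H →L[ℂ] H} (hA : HasSum (fun i => rankOne ℂ (x i) (y i)) A)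
    (hs : Summable fun i => ‖x i‖ * ‖y i‖) : IsTraceClass A := by
  refine ⟨isCompactOperator_of_hasSum (fun i => isCompactOperator_rankOne _ _) hA, ?_⟩
  refine lt_of_le_of_lt ?_ (ENNReal.ofReal_lt_top (r := ∑' i, ‖x i‖ * ‖y i‖))
  rw [singularValueSum, ENNReal.tsum_eq_iSup_sum]
  refine iSup_le fun S => ?_
  set T : H →ₗ[ℂ] H := ((CFC.abs A : H →L[ℂ] H) : H →ₗ[ℂ] H) with hT
  have hsymm : T.IsSymmetric :=
    (ContinuousLinearMap.isSelfAdjoint_iff_isSymmetric).1 (CFC.abs_nonneg A).isSelfAdjoint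
  choose b hb using fun s : S => exists_orthonormal_finrank
    (Module.End.eigenspace T (((s : {s : ℝ // 0 < s}) : ℝ) : ℂ))
  have hfam := hsymm.orthogonalFamily_eigenspaces.comp
    (γ := S) (f := fun s => (((s : {s : ℝ // 0 < s}) : ℝ) : ℂ))
    (fun s t h => Subtype.ext (Subtype.ext (Complex.ofReal_injective h)))
  have hv := hfam.orthonormal_sigma_orthonormal hb
  have hu := orthonormal_inv_smul_apply_of_abs_eigenvector A hv
    (s := fun a => ((a.1 : {s : ℝ // 0 < s}) : ℝ)) (fun a => a.1.1.2)
    (fun a => Module.End.mem_eigenspace_iff.1 (b a.1 a.2).2)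
  have hle := norm_sum_inner_le_of_hasSum_rankOne hA hs hu hv
  have hval : ∑ s ∈ S, (Module.finrank ℂ (Module.End.eigenspace T ((s : ℝ) : ℂ)) : ENNReal)
      * ENNReal.ofReal s = ENNReal.ofReal (∑ a : (Σ s : S, Fin (Module.finrank ℂ
        (Module.End.eigenspace T (((s : {s : ℝ // 0 < s}) : ℝ) : ℂ)))),
          ((a.1 : {s : ℝ // 0 < s}) : ℝ)) := by
    rw [ENNReal.ofReal_sum_of_nonneg fun a _ => a.1.1.2.le, Fintype.sum_sigma,
      ← Finset.sum_coe_sort S]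
    simp
  rw [hval]
  refine ENNReal.ofReal_le_ofReal (le_trans (le_of_eq ?_) hle)
  have h3 : ∀ a : (Σ s : S, Fin (Module.finrank ℂ
      (Module.End.eigenspace T (((s : {s : ℝ // 0 < s}) : ℝ) : ℂ)))),
      inner ℂ ((((a.1 : {s : ℝ // 0 < s}) : ℝ) : ℂ)⁻¹ • A (b a.1 a.2 : H)) (A (b a.1 a.2 : H))
        = (((a.1 : {s : ℝ // 0 < s}) : ℝ) : ℂ) := fun a => by
    have hpos : ((((a.1 : {s : ℝ // 0 < s}) : ℝ) : ℂ)) ≠ 0 := by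
      exact_mod_cast a.1.1.2.ne'
    have h4 := hu.1 a
    have h5 : A (b a.1 a.2 : H) = (((a.1 : {s : ℝ // 0 < s}) : ℝ) : ℂ) •
        ((((a.1 : {s : ℝ // 0 < s}) : ℝ) : ℂ)⁻¹ • A (b a.1 a.2 : H)) := by
      rw [smul_smul, mul_inv_cancel₀ hpos, one_smul]
    conv_lhs => rw [h5]
    rw [smul_smul, inv_mul_cancel₀ hpos, one_smul, inner_smul_right]
    erw [inner_self_eq_norm_sq_to_K, h4]
    simp
  have h6 : ∑ a : (Σ s : S, Fin (Module.finrank ℂ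
      (Module.End.eigenspace T (((s : {s : ℝ // 0 < s}) : ℝ) : ℂ)))),
      inner ℂ ((((a.1 : {s : ℝ // 0 < s}) : ℝ) : ℂ)⁻¹ • A (b a.1 a.2 : H)) (A (b a.1 a.2 : H))
      = ((∑ a : (Σ s : S, Fin (Module.finrank ℂ
        (Module.End.eigenspace T (((s : {s : ℝ // 0 < s}) : ℝ) : ℂ)))),
          ((a.1 : {s : ℝ // 0 < s}) : ℝ) : ℝ) : ℂ) := by
    rw [Complex.ofReal_sum]
    exact Finset.sum_congr rfl fun a _ => h3 a
  erw [h6]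
  rw [Complex.norm_real, Real.norm_of_nonneg (Finset.sum_nonneg fun a _ => a.1.1.2.le)]

end TraceClass

/-! ### Localization operators with bounded coefficients -/

section Operators

variable {n : ℕ}

/-- The bounded families of coefficients indexed by `ℤⁿ × ℤⁿ`. -/
abbrev BddCoeff (n : ℕ) : Type := BoundedContinuousFunction (Zn n × Zn n) ℂ

theorem norm_weighted_rpow_le (s t : Zn n) (c : BddCoeff n) (f : ell2 n) (k : Zn n) :
    ‖c (k - s, t - s) * f (k - s + t)‖ ^ (2 : ENNReal).toReal
      ≤ ‖c‖ ^ (2 : ENNReal).toReal * ‖f (k - s + t)‖ ^ (2 : ENNReal).toReal := by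
  rw [norm_mul, Real.mul_rpow (norm_nonneg _) (norm_nonneg _)]
  gcongr
  exact c.norm_coe_le_norm _

theorem hasSum_norm_translate_rpow (s t : Zn n) (f : ell2 n) :
    HasSum (fun k => ‖f (k - s + t)‖ ^ (2 : ENNReal).toReal) (‖f‖ ^ (2 : ENNReal).toReal) :=
  ((Equiv.subRight s).trans (Equiv.addRight t)).hasSum_iff.2
    (lp.hasSum_norm (p := 2) (by norm_num) f)

theorem summable_norm_weighted_rpow (s t : Zn n) (c : BddCoeff n) (f : ell2 n) :
    Summable fun k => ‖c (k - s, t - s) * f (k - s + t)‖ ^ (2 : ENNReal).toReal :=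
  Summable.of_nonneg_of_le (fun _ => Real.rpow_nonneg (norm_nonneg _) _)
    (norm_weighted_rpow_le s t c f) ((hasSum_norm_translate_rpow s t f).summable.mul_left _)

/-- The sequence `k ↦ c(k - s, t - s) f(k - s + t)` in `ℓ²(ℤⁿ)`. -/
def weightedTranslate (s t : Zn n) (c : BddCoeff n) (f : ell2 n) : ell2 n :=
  ⟨fun k => c (k - s, t - s) * f (k - s + t), memℓp_gen (summable_norm_weighted_rpow s t c f)⟩

theorem norm_weightedTranslate_le (s t : Zn n) (c : BddCoeff n) (f : ell2 n) :
    ‖weightedTranslate s t c f‖ ≤ ‖c‖ * ‖f‖ := by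
  refine lp.norm_le_of_tsum_le (by norm_num) (by positivity) ?_
  rw [Real.mul_rpow (norm_nonneg _) (norm_nonneg _)]
  exact ((summable_norm_weighted_rpow s t c f).tsum_le_tsum (norm_weighted_rpow_le s t c f)
    ((hasSum_norm_translate_rpow s t f).summable.mul_left _)).trans
      (le_of_eq ((hasSum_norm_translate_rpow s t f).mul_left _).tsum_eq)

/-- The weighted shift `f ↦ (k ↦ c(k - s, t - s) f(k - s + t))` on `ℓ²(ℤⁿ)`. -/
def weightedShift (s t : Zn n) (c : BddCoeff n) : ell2 n →L[ℂ] ell2 n :=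
  LinearMap.mkContinuous
    { toFun := weightedTranslate s t c
      map_add' := fun f f' => lp.ext (funext fun _ => mul_add (c _) (f _) (f' _))
      map_smul' := fun a f => lp.ext (funext fun _ => mul_left_comm (c _) a (f _)) }
    ‖c‖ (norm_weightedTranslate_le s t c)

theorem norm_weightedShift_le (s t : Zn n) (c : BddCoeff n) : ‖weightedShift s t c‖ ≤ ‖c‖ :=
  LinearMap.mkContinuous_norm_le _ (norm_nonneg c) _

theorem weightedShift_sub (s t : Zn n) (c c' : BddCoeff n) :
    weightedShift s t (c - c') = weightedShift s t c - weightedShift s t c' :=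
  ContinuousLinearMap.ext fun f => lp.ext (funext fun _ => sub_mul (c _) (c' _) (f _))

/-- The localization operator with windows `g₁, g₂`, as a function of the Fourier coefficients
of its symbol. -/
def coeffLocOp (g₁ g₂ : Zn n → ℂ) (c : BddCoeff n) : ell2 n →L[ℂ] ell2 n :=
  ∑' q : Zn n × Zn n, (g₂ q.1 * starRingEnd ℂ (g₁ q.2)) • weightedShift q.1 q.2 c

theorem summable_norm_windows {g₁ g₂ : Zn n → ℂ} (h₁ : Summable fun k => ‖g₁ k‖)
    (h₂ : Summable fun k => ‖g₂ k‖) :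
    Summable fun q : Zn n × Zn n => ‖g₂ q.1 * starRingEnd ℂ (g₁ q.2)‖ := by
  simpa [norm_mul] using h₂.mul_of_nonneg h₁ (fun _ => norm_nonneg _) (fun _ => norm_nonneg _)

theorem norm_smul_weightedShift_le (a : ℂ) (s t : Zn n) (c : BddCoeff n) :
    ‖a • weightedShift s t c‖ ≤ ‖a‖ * ‖c‖ := by
  rw [norm_smul]
  exact mul_le_mul_of_nonneg_left (norm_weightedShift_le s t c) (norm_nonneg _)

theorem hasSum_coeffLocOp_apply {g₁ g₂ : Zn n → ℂ} (h₁ : Summable fun k => ‖g₁ k‖)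
    (h₂ : Summable fun k => ‖g₂ k‖) (c : BddCoeff n) :
    HasSum (fun q : Zn n × Zn n =>
      (g₂ q.1 * starRingEnd ℂ (g₁ q.2)) • weightedShift q.1 q.2 c) (coeffLocOp g₁ g₂ c) :=
  (Summable.of_norm_bounded ((summable_norm_windows h₁ h₂).mul_right ‖c‖) fun q =>
    norm_smul_weightedShift_le _ q.1 q.2 c).hasSum

/-- This estimate makes the continuous extension possible: only the sup norm of the coefficients
matters for the operator norm. -/
theorem norm_coeffLocOp_sub_le {g₁ g₂ : Zn n → ℂ} (h₁ : Summable fun k => ‖g₁ k‖)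
    (h₂ : Summable fun k => ‖g₂ k‖) (c c' : BddCoeff n) :
    ‖coeffLocOp g₁ g₂ c - coeffLocOp g₁ g₂ c'‖ ≤
      (∑' q : Zn n × Zn n, ‖g₂ q.1 * starRingEnd ℂ (g₁ q.2)‖) * ‖c - c'‖ := by
  refine ((hasSum_coeffLocOp_apply h₁ h₂ c).sub
    (hasSum_coeffLocOp_apply h₁ h₂ c')).norm_le_of_bounded
      ((summable_norm_windows h₁ h₂).hasSum.mul_right ‖c - c'‖) fun q => ?_
  rw [← smul_sub, ← weightedShift_sub]
  exact norm_smul_weightedShift_le _ q.1 q.2 _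

theorem tendsto_coeffLocOp {g₁ g₂ : Zn n → ℂ} (h₁ : Summable fun k => ‖g₁ k‖)
    (h₂ : Summable fun k => ‖g₂ k‖) {α : Type*} {l : Filter α} {c : α → BddCoeff n}
    {c₀ : BddCoeff n} (hc : Filter.Tendsto c l (nhds c₀)) :
    Filter.Tendsto (fun i => coeffLocOp g₁ g₂ (c i)) l (nhds (coeffLocOp g₁ g₂ c₀)) := by
  rw [tendsto_iff_norm_sub_tendsto_zero] at hc ⊢
  have h := hc.const_mul (∑' q : Zn n × Zn n, ‖g₂ q.1 * starRingEnd ℂ (g₁ q.2)‖)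
  rw [mul_zero] at h
  exact squeeze_zero (fun _ => norm_nonneg _) (fun i => norm_coeffLocOp_sub_le h₁ h₂ (c i) c₀) h

theorem hasSum_coeffLocOp_apply_apply {g₁ g₂ : Zn n → ℂ} (h₁ : Summable fun k => ‖g₁ k‖)
    (h₂ : Summable fun k => ‖g₂ k‖) (c : BddCoeff n) (f : ell2 n)
    (k : Zn n) :
    HasSum (fun q : Zn n × Zn n => (g₂ q.1 * starRingEnd ℂ (g₁ q.2)) *
      (c (k - q.1, q.2 - q.1) * f (k - q.1 + q.2))) (coeffLocOp g₁ g₂ c f k) := by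
  have h := ((hasSum_coeffLocOp_apply h₁ h₂ c).mapL (ContinuousLinearMap.apply ℂ _ f)).mapL
    (lp.evalCLM ℂ (fun _ : Zn n => ℂ) 2 k)
  simpa using! h

/-- Termwise integration for absolutely summable coefficients and `χ` bounded by 1. It serves both
to compute the localization integral and to extract single Fourier coefficients by orthogonality. -/
theorem hasSum_integral_mul_of_summable {α ι : Type*} [Countable ι] [MeasurableSpace α]
    {μ : Measure α} {v : α → ℂ} (hv : Integrable v μ) {χ : ι → α → ℂ}
    (hχ : ∀ i, AEStronglyMeasurable (χ i) μ) (hχ1 : ∀ i x, ‖χ i x‖ ≤ 1) {b : ι → ℂ}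
    (hb : Summable fun i => ‖b i‖) :
    HasSum (fun i => b i * ∫ x, v x * χ i x ∂μ) (∫ x, v x * ∑' i, b i * χ i x ∂μ) := by
  have hint : ∀ i, Integrable (fun x => v x * (b i * χ i x)) μ := fun i => by
    refine hv.mul_bdd (c := ‖b i‖) ((hχ i).const_mul _) (Filter.Eventually.of_forall fun x => ?_)
    rw [norm_mul]
    exact mul_le_of_le_one_right (norm_nonneg _) (hχ1 i x)
  have h := hasSum_integral_of_summable_integral_norm hint (by
    refine Summable.of_nonneg_of_le (fun i => integral_nonneg fun x => norm_nonneg _)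
      (fun i => ?_) (hb.mul_left (∫ x, ‖v x‖ ∂μ))
    rw [← integral_mul_const]
    refine integral_mono (hint i).norm (hv.norm.mul_const _) fun x => ?_
    simp only [norm_mul]
    gcongr
    exact mul_le_of_le_one_right (norm_nonneg _) (hχ1 i x))
  have h1 : ∀ i, b i * ∫ x, v x * χ i x ∂μ = ∫ x, v x * (b i * χ i x) ∂μ := fun i => by
    rw [← integral_const_mul]
    exact integral_congr_ae (Filter.Eventually.of_forall fun x => mul_left_comm _ _ _)
  simpa only [h1, ← tsum_mul_left] using h

/-! ### Characters, and the integral formula for the operator. -/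

theorem continuous_chr (k : Zn n) : Continuous (chr k : Tn n → ℂ) :=
  (UnitAddTorus.mFourier k).continuous

theorem chr_neg (k : Zn n) (w : Tn n) : chr (-k) w = starRingEnd ℂ (chr k w) :=
  UnitAddTorus.mFourier_neg

theorem chr_add_left (k l : Zn n) (w : Tn n) : chr (k + l) w = chr k w * chr l w :=
  UnitAddTorus.mFourier_add

theorem chr_zero (w : Tn n) : chr 0 w = 1 := by
  simp [chr, UnitAddTorus.mFourier_zero]

instance : IsProbabilityMeasure (haarT n) :=
  inferInstanceAs (IsProbabilityMeasure (Measure.pi fun _ => AddCircle.haarAddCircle))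

instance : (haarT n).IsAddHaarMeasure :=
  inferInstanceAs (Measure.pi fun _ => AddCircle.haarAddCircle).IsAddHaarMeasure

instance : SFinite (haarZT n) :=
  inferInstanceAs (SFinite (Measure.count.prod (haarT n)))

theorem integrable_slice {u : Zn n × Tn n → ℂ} (hu : Integrable u (haarZT n)) (m : Zn n) :
    Integrable (fun w => u (m, w)) (haarT n) :=
  Measure.ae_count_iff.1 hu.prod_right_ae m

theorem isLocOpFun_coeffLocOp {g₁ g₂ : Zn n → ℂ} (h₁ : Summable fun k => ‖g₁ k‖)
    (h₂ : Summable fun k => ‖g₂ k‖) {u : Zn n × Tn n → ℂ} (hu : Integrable u (haarZT n))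
    {c : BddCoeff n} (hc : ∀ m j, c (m, j) = ∫ w, u (m, w) * chr (-j) w ∂haarT n) :
    IsLocOpFun g₁ g₂ u (coeffLocOp g₁ g₂ c) := by
  intro f k
  -- The substitution `s = k - m`, `t = r - m`, where `r` is the summation index in `V_{g₁} f(m,
  -- w)`. The torus integral of `u(m, ·)` against `e_{k-r}` is `c(m, r - k) = c(k - s, t - s)`.
  let e : Zn n × Zn n ≃ Zn n × Zn n :=
    { toFun := fun q => (k - q.1, q.2 - q.1)
      invFun := fun q => (k - q.1, k - q.1 + q.2)
      left_inv := fun q => by ext <;> simp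
      right_inv := fun q => by ext <;> simp }
  have hT := e.hasSum_iff.2 (hasSum_coeffLocOp_apply_apply h₁ h₂ c f k)
  have hfib : ∀ m : Zn n, HasSum (fun r => ((fun q : Zn n × Zn n =>
      (g₂ q.1 * starRingEnd ℂ (g₁ q.2)) * (c (k - q.1, q.2 - q.1) * f (k - q.1 + q.2))) ∘ e)
        (m, r)) (∫ w, u (m, w) * stftZ g₁ f (m, w) * shiftZ m w g₂ k ∂haarT n) := fun m => by
    have hb : Summable fun r => ‖(f r * starRingEnd ℂ (g₁ (r - m))) * g₂ (k - m)‖ := by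
      simp only [norm_mul, RCLike.norm_conj]
      refine Summable.mul_right _ (Summable.of_nonneg_of_le (fun r => by positivity)
        (fun r => ?_) (((Equiv.subRight m).summable_iff.2 h₁).mul_left ‖f‖))
      exact mul_le_mul_of_nonneg_right (lp.norm_apply_le_norm two_ne_zero f r) (norm_nonneg _)
    have h := hasSum_integral_mul_of_summable (integrable_slice hu m)
      (χ := fun r w => chr (k - r) w)
      (fun r => (continuous_chr _).aestronglyMeasurable) (fun r w => (norm_chr _ _).le) hb
    convert h using 1
    · funext r
      simp only [Function.comp, e, Equiv.coe_fn_mk]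
      rw [show k - (k - m) = m by abel, show r - m - (k - m) = r - k by abel,
        show m + (r - m) = r by abel, hc, neg_sub]
      ring
    · congr 1
      funext w
      rw [mul_assoc]
      congr 1
      rw [stftZ, shiftZ, ← tsum_mul_right]
      congr 1
      funext r
      rw [shiftZ, sub_eq_add_neg k r, chr_add_left, chr_neg, map_mul]
      ring
  exact (HasSum.prod_fiberwise hT hfib).tsum_eq.symm

theorem IsLocOpFun.unique {g₁ g₂ : Zn n → ℂ} {u : Zn n × Tn n → ℂ} {A B : ell2 n →L[ℂ] ell2 n}
    (hA : IsLocOpFun g₁ g₂ u A) (hB : IsLocOpFun g₁ g₂ u B) : A = B := by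
  ext f k
  rw [hA, hB]

/-- The standard unit vectors of `ℓ²(ℤⁿ)`. -/
def unitVec (k : Zn n) : ell2 n := lp.single 2 k (1 : ℂ)

theorem norm_unitVec (k : Zn n) : ‖unitVec k‖ = 1 := by
  rw [unitVec, lp.norm_single (by norm_num), norm_one]

theorem unitVec_apply_self (k : Zn n) : unitVec k k = 1 :=
  lp.single_apply_self _ _ _

theorem unitVec_apply_of_ne {k l : Zn n} (h : l ≠ k) : unitVec k l = 0 :=
  lp.single_apply_ne _ _ _ h

theorem inner_unitVec (k : Zn n) (f : ell2 n) : inner ℂ (unitVec k) f = f k := by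
  rw [unitVec, lp.inner_single_left]
  simp

theorem weightedShift_hasSum_rankOne (s t : Zn n) {c : BddCoeff n}
    (hc : Summable fun q => ‖c q‖) :
    HasSum (fun m => c (m, t - s) • InnerProductSpace.rankOne ℂ
      (unitVec (m + s)) (unitVec (m + t))) (weightedShift s t c) := by
  have hs : Summable (fun m => c (m, t - s) • InnerProductSpace.rankOne ℂ
      (unitVec (m + s)) (unitVec (m + t))) := by
    refine Summable.of_norm_bounded
      (hc.comp_injective (i := fun m : Zn n => (m, t - s)) fun a b h => (Prod.ext_iff.1 h).1)
      fun m => ?_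
    rw [norm_smul, InnerProductSpace.norm_rankOne, norm_unitVec, norm_unitVec, mul_one, mul_one]
    rfl
  convert hs.hasSum
  ext f k
  have h := (hs.hasSum.mapL (ContinuousLinearMap.apply ℂ _ f)).mapL
    (lp.evalCLM ℂ (fun _ : Zn n => ℂ) 2 k)
  refine HasSum.unique ?_ h
  have hterm : ∀ m, (lp.evalCLM ℂ (fun _ : Zn n => ℂ) 2 k) ((ContinuousLinearMap.apply ℂ _ f)
      (c (m, t - s) • InnerProductSpace.rankOne ℂ (unitVec (m + s)) (unitVec (m + t))))
      = c (m, t - s) * (f (m + t) * unitVec (m + s) k) := fun m => by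
    change c (m, t - s) * (inner ℂ (unitVec (m + t)) f * unitVec (m + s) k) = _
    rw [inner_unitVec]
  -- Only `m = k - s` reaches the coordinate `k`.
  have h0 := hasSum_single (f := fun m => c (m, t - s) * (f (m + t) * unitVec (m + s) k))
    (k - s) fun m hm => by
      rw [unitVec_apply_of_ne (fun h => hm (by rw [h]; abel)), mul_zero, mul_zero]
  rw [sub_add_cancel, unitVec_apply_self, mul_one] at h0
  simpa only [hterm] using! h0

/-- A single nuclear series over `(s, t, m)`, whose norms sum to at most `‖g₁‖₁ ‖g₂‖₁ ‖c‖₁`. -/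
theorem isTraceClass_coeffLocOp {g₁ g₂ : Zn n → ℂ} (h₁ : Summable fun k => ‖g₁ k‖)
    (h₂ : Summable fun k => ‖g₂ k‖) {c : BddCoeff n}
    (hc : Summable fun q => ‖c q‖) : IsTraceClass (coeffLocOp g₁ g₂ c) := by
  let x : (Zn n × Zn n) × Zn n → ell2 n := fun i =>
    ((g₂ i.1.1 * starRingEnd ℂ (g₁ i.1.2)) * c (i.2, i.1.2 - i.1.1)) •
      unitVec (i.2 + i.1.1)
  let y : (Zn n × Zn n) × Zn n → ell2 n := fun i => unitVec (i.2 + i.1.2)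
  have hsum : Summable fun i => ‖x i‖ * ‖y i‖ := by
    have hinj : ∀ d : Zn n, Function.Injective fun m : Zn n => (m, d) := fun d a b h =>
      (Prod.ext_iff.1 h).1
    have hm : ∀ d : Zn n, Summable fun m => ‖c (m, d)‖ := fun d => hc.comp_injective (hinj d)
    -- A bound uniform in `d = t - s` is what lets the sum over `m` separate from the sum over the
    -- windows.
    have hd : ∀ d : Zn n, ∑' m, ‖c (m, d)‖ ≤ ∑' q, ‖c q‖ := fun d =>
      tsum_comp_le_tsum_of_inj hc (fun _ => norm_nonneg _) (hinj d)
    have hxy : ∀ i, ‖x i‖ * ‖y i‖ =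
        ‖g₂ i.1.1 * starRingEnd ℂ (g₁ i.1.2)‖ * ‖c (i.2, i.1.2 - i.1.1)‖ := fun i => by
      simp only [x, y]
      rw [norm_smul, norm_unitVec, norm_unitVec, norm_mul, mul_one, mul_one]
    refine (summable_congr hxy).2 ((summable_prod_of_nonneg fun i =>
      mul_nonneg (norm_nonneg _) (norm_nonneg _)).2
        ⟨fun q => (hm (q.2 - q.1)).mul_left ‖g₂ q.1 * starRingEnd ℂ (g₁ q.2)‖, ?_⟩)
    refine Summable.of_nonneg_of_le
      (fun q => tsum_nonneg fun m => mul_nonneg (norm_nonneg _) (norm_nonneg _)) (fun q => ?_)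
      ((summable_norm_windows h₁ h₂).mul_right (∑' q, ‖c q‖))
    have h := mul_le_mul_of_nonneg_left (hd (q.2 - q.1))
      (norm_nonneg (g₂ q.1 * starRingEnd ℂ (g₁ q.2)))
    rwa [← tsum_mul_left] at h
  refine isTraceClass_of_hasSum_rankOne (x := x) (y := y) ?_ hsum
  have hs : Summable fun i => InnerProductSpace.rankOne ℂ (x i) (y i) :=
    Summable.of_norm (by simpa only [InnerProductSpace.norm_rankOne] using hsum)
  convert hs.hasSum
  refine (hasSum_coeffLocOp_apply h₁ h₂ c).unique
    (HasSum.prod_fiberwise hs.hasSum fun q => ?_)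
  have h := (weightedShift_hasSum_rankOne q.1 q.2 hc).const_smul
    (g₂ q.1 * starRingEnd ℂ (g₁ q.2))
  convert h using 1
  funext m
  simp only [x, y, map_smul, smul_apply, smul_smul]

end Operators

/-! ### Fourier series of Schwartz functions on `ℤⁿ × 𝕋ⁿ` -/

section FourierSeries

variable {n : ℕ}

theorem summable_int_inv_sq : Summable fun k : ℤ => ((1 + |(k : ℝ)|) ^ 2)⁻¹ := by
  have h : Summable fun k : ℤ => 1 / (k : ℝ) ^ 2 := Real.summable_one_div_int_pow.2 one_lt_two
  -- The comparison fails at `k = 0`, where `1 / 0 ^ 2` is `0`; hence only cofinitely.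
  refine Summable.of_norm_bounded_eventually h ?_
  filter_upwards [(Set.finite_singleton (0 : ℤ)).compl_mem_cofinite] with k hk
  have hk' : (k : ℝ) ≠ 0 := by exact_mod_cast hk
  rw [Real.norm_of_nonneg (by positivity), one_div, ← sq_abs (k : ℝ)]
  gcongr
  linarith

/-- A finite set of indices lies in the box spanned by its coordinate projections, over which the
sum factorizes. -/
theorem summable_prod_pi {f : ℤ → ℝ} (hf : Summable f) (h0 : ∀ k, 0 ≤ f k) :
    Summable fun k : Zn n => ∏ i, f (k i) := by
  refine summable_of_sum_le (c := ∏ _i : Fin n, ∑' k, f k)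
    (fun k => Finset.prod_nonneg fun i _ => h0 _) fun s => ?_
  calc ∑ k ∈ s, ∏ i, f (k i)
      ≤ ∑ k ∈ Fintype.piFinset fun i => s.image fun k => k i, ∏ i, f (k i) :=
        Finset.sum_le_sum_of_subset_of_nonneg
          (fun k hk => Fintype.mem_piFinset.2 fun i => Finset.mem_image_of_mem _ hk)
          fun k _ _ => Finset.prod_nonneg fun i _ => h0 _
    _ = ∏ i : Fin n, ∑ l ∈ s.image fun k => k i, f l := (Finset.prod_univ_sum _ _).symm
    _ ≤ ∏ _i : Fin n, ∑' k, f k := Finset.prod_le_prod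
        (fun i _ => Finset.sum_nonneg fun l _ => h0 l)
        fun i _ => hf.sum_le_tsum _ fun l _ => h0 l

/-- The reciprocals of a sufficiently high power of `1 + ‖k‖` are summable over `ℤⁿ`. -/
theorem summable_inv_pow (n : ℕ) : Summable fun k : Zn n => ((1 + ‖k‖) ^ (2 * n))⁻¹ := by
  refine Summable.of_nonneg_of_le (fun k => by positivity) (fun k => ?_)
    (summable_prod_pi summable_int_inv_sq fun k => by positivity)
  rw [Finset.prod_inv_distrib]
  gcongr
  calc ∏ i, (1 + |(k i : ℝ)|) ^ 2 ≤ ∏ _i : Fin n, (1 + ‖k‖) ^ 2 := by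
        refine Finset.prod_le_prod (fun i _ => by positivity) fun i _ => ?_
        gcongr
        rw [← Int.norm_eq_abs]
        exact norm_le_pi_norm k i
    _ = (1 + ‖k‖) ^ (2 * n) := by simp [pow_mul]

/-- The projection `ℝⁿ → 𝕋ⁿ`. -/
def toTorus (x : Fin n → ℝ) : Tn n := fun i => (x i : UnitAddCircle)

theorem exists_toTorus_eq (w : Tn n) : ∃ x : Fin n → ℝ, toTorus x = w := by
  have hr : ∀ i, ∃ r : ℝ, (r : UnitAddCircle) = w i := fun i =>
    QuotientAddGroup.mk_surjective (w i)
  choose r hr using hr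
  exact ⟨r, funext hr⟩

theorem toTorus_sub (x y : Fin n → ℝ) : toTorus (x - y) = toTorus x - toTorus y :=
  funext fun i => AddCircle.coe_sub 1 (x i) (y i)

theorem chr_toTorus (l : Zn n) (x : Fin n → ℝ) :
    chr l (toTorus x) = Complex.exp (2 * Real.pi * Complex.I * ∑ i, (l i : ℝ) * x i) := by
  simp only [chr, UnitAddTorus.mFourier, toTorus, ContinuousMap.coe_mk, fourier_coe_apply,
    ← Complex.exp_sum]
  congr 1
  push_cast
  rw [Finset.mul_sum]
  refine Finset.sum_congr rfl fun i _ => ?_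
  ring

/-! ### Decay of Fourier coefficients of smooth functions. -/

theorem continuous_of_toTorus {F : Tn n → ℂ} (hF : Continuous fun x => F (toTorus x)) :
    Continuous F := by
  have h : IsOpenQuotientMap (toTorus : (Fin n → ℝ) → Tn n) :=
    IsOpenQuotientMap.piMap fun _ => QuotientAddGroup.isOpenQuotientMap_mk
  exact h.isQuotientMap.continuous_iff.2 hF

theorem integrable_of_continuous {F : Tn n → ℂ} (hF : Continuous F) : Integrable F (haarT n) :=
  hF.integrable_of_hasCompactSupport (HasCompactSupport.of_compactSpace F)

/-- The Fourier coefficients of a function on the torus. -/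
def fcoeff (F : Tn n → ℂ) (j : Zn n) : ℂ := ∫ w, chr (-j) w * F w ∂haarT n

theorem norm_fcoeff_le {F : Tn n → ℂ} {C : ℝ} (hF : ∀ w, ‖F w‖ ≤ C) (j : Zn n) :
    ‖fcoeff F j‖ ≤ C := by
  have h := norm_integral_le_of_norm_le_const (μ := haarT n) (f := fun w => chr (-j) w * F w)
    (C := C) (Filter.Eventually.of_forall fun w => by rw [norm_mul, norm_chr, one_mul]; exact hF w)
  simpa using! h

theorem fcoeff_translate (F : Tn n → ℂ) (h : Tn n) (j : Zn n) :
    fcoeff (fun w => F (w - h)) j = chr (-j) h * fcoeff F j := by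
  rw [fcoeff, fcoeff, ← integral_const_mul,
    ← integral_sub_right_eq_self (fun w => chr (-j) h * (chr (-j) w * F w)) h]
  refine integral_congr_ae (Filter.Eventually.of_forall fun w => ?_)
  change chr (-j) w * F (w - h) = chr (-j) h * (chr (-j) (w - h) * F (w - h))
  rw [← mul_assoc, ← chr_add, add_sub_cancel]

/-- Decay of Fourier coefficients of smooth functions, by iterated differences. -/
theorem two_pow_mul_norm_fcoeff_le {j : Zn n} {h : Fin n → ℝ} (hh : chr (-j) (toTorus h) = -1)
    (M : ℕ) : ∀ (F : Tn n → ℂ) (C : ℝ), ContDiff ℝ ∞ (fun x => F (toTorus x)) →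
      (∀ x, ‖iteratedFDeriv ℝ M (fun x => F (toTorus x)) x‖ ≤ C) →
        2 ^ M * ‖fcoeff F j‖ ≤ ‖h‖ ^ M * C := by
  induction M with
  | zero =>
    intro F C hF hC
    rw [pow_zero, pow_zero, one_mul, one_mul]
    refine norm_fcoeff_le (fun w => ?_) j
    obtain ⟨x, rfl⟩ := exists_toTorus_eq w
    simpa using! hC x
  | succ M ih =>
    intro F C hF hC
    have hcont : Continuous F := continuous_of_toTorus hF.continuous
    -- Since `e_{-j}(h) = -1`, differencing doubles the `j`-th coefficient, while the mean value
    -- inequality bounds the `M`-th derivative of `G` by `‖h‖` times the `(M+1)`-st of `F`. This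
    -- trades one derivative for a factor `‖h‖ / 2`.
    set G : Tn n → ℂ := fun w => F w - F (w - toTorus h) with hG
    have hM : ((M : ℕ∞) : WithTop ℕ∞) ≤ ∞ := by exact_mod_cast le_top
    have hlift : (fun x => G (toTorus x)) =
        (fun x => F (toTorus x)) - fun x => (fun x => F (toTorus x)) (x - h) := by
      funext x
      simp only [hG, Pi.sub_apply, toTorus_sub]
    have hshift : ContDiff ℝ ∞ fun x => (fun x => F (toTorus x)) (x - h) :=
      hF.comp (contDiff_id.sub contDiff_const)
    have h1 := ih G (C * ‖h‖) (by rw [hlift]; exact hF.sub hshift) fun x => by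
      rw [hlift, iteratedFDeriv_sub_apply (hF.of_le hM).contDiffAt
        (hshift.of_le hM).contDiffAt,
        iteratedFDeriv_comp_sub (f := fun x => F (toTorus x)) M h x]
      have h2 := convex_univ.norm_image_sub_le_of_norm_fderiv_le (𝕜 := ℝ)
        (f := iteratedFDeriv ℝ M fun x => F (toTorus x)) (C := C) (x := x - h) (y := x)
        (fun y _ => (hF.differentiable_iteratedFDeriv
          (by exact_mod_cast WithTop.coe_lt_top M)).differentiableAt)
        (fun y _ => by rw [norm_fderiv_iteratedFDeriv]; exact hC y)
        (Set.mem_univ _) (Set.mem_univ _)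
      rwa [sub_sub_cancel] at h2
    have h3 : fcoeff G j = 2 * fcoeff F j := by
      have h4 : fcoeff G j = fcoeff F j - fcoeff (fun w => F (w - toTorus h)) j := by
        rw [fcoeff, fcoeff, fcoeff, ← integral_sub]
        · refine integral_congr_ae (Filter.Eventually.of_forall fun w => ?_)
          exact mul_sub _ _ _
        · exact integrable_of_continuous ((continuous_chr _).mul hcont)
        · exact integrable_of_continuous ((continuous_chr _).mul
            (hcont.comp (continuous_sub_right _)))
      rw [h4, fcoeff_translate, hh]
      ring
    rw [h3, norm_mul, Complex.norm_two] at h1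
    calc _ = 2 ^ M * (2 * ‖fcoeff F j‖) := by ring
      _ ≤ _ := h1
      _ = _ := by ring

theorem exists_norm_eq_chr_eq_neg_one {j : Zn n} (hj : j ≠ 0) :
    ∃ h : Fin n → ℝ, ‖h‖ = (2 * ‖j‖)⁻¹ ∧ chr (-j) (toTorus h) = -1 := by
  have : Nonempty (Fin n) := by
    by_contra hne
    rw [not_nonempty_iff] at hne
    exact hj (Subsingleton.elim _ _)
  obtain ⟨i, -, hi⟩ := Finset.exists_mem_eq_sup' Finset.univ_nonempty fun i => ‖j i‖
  have hmax : ‖j‖ = ‖j i‖ := le_antisymm ((pi_norm_le_iff_of_nonneg (norm_nonneg _)).2 fun l => by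
    rw [← hi]; exact Finset.le_sup' (fun i => ‖j i‖) (Finset.mem_univ l)) (norm_le_pi_norm j i)
  have hji : (j i : ℝ) ≠ 0 := by
    intro h0
    apply hj
    rw [← norm_eq_zero, hmax, Int.norm_eq_abs, h0, abs_zero]
  -- Half a period of the character in the direction of the largest coordinate of `j`, so that the
  -- shift is as short as `1 / (2‖j‖)`.
  refine ⟨Pi.single i (2 * (j i : ℝ))⁻¹, ?_, ?_⟩
  · rw [Pi.norm_single, hmax, norm_inv, norm_mul, Int.norm_eq_abs, Real.norm_eq_abs,
      Real.norm_eq_abs, abs_two]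
  · rw [chr_toTorus, Finset.sum_eq_single i (fun l _ hl => by simp [hl]) (by simp)]
    have : (2 * Real.pi * Complex.I * (((-j) i : ℤ) * (Pi.single i (2 * (j i : ℝ))⁻¹ :
        Fin n → ℝ) i : ℝ) : ℂ) = -(Real.pi * Complex.I) := by
      have hji' : (j i : ℂ) ≠ 0 := by exact_mod_cast hji
      rw [Pi.single_eq_same, Pi.neg_apply]
      push_cast
      field_simp
    simp only [Complex.ofReal_mul, Complex.ofReal_intCast] at this ⊢
    rw [this, Complex.exp_neg, Complex.exp_pi_mul_I]
    norm_num

/-- For `j ≠ 0` the half-period shift has `‖h‖ = 1 / (2‖j‖)`, and `1 + ‖j‖ ≤ 2‖j‖` since `j` is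
integral; for `j = 0` the trivial bound `C` suffices. The factor `2 ^ M` is slack. -/
theorem one_add_pow_mul_norm_fcoeff_le {F : Tn n → ℂ} (hF : ContDiff ℝ ∞ fun x => F (toTorus x))
    {M : ℕ} {C D : ℝ} (hC : ∀ w, ‖F w‖ ≤ C)
    (hD : ∀ x, ‖iteratedFDeriv ℝ M (fun x => F (toTorus x)) x‖ ≤ D) (j : Zn n) :
    (1 + ‖j‖) ^ M * ‖fcoeff F j‖ ≤ 2 ^ M * (C + D) := by
  have hC0 : 0 ≤ C := (norm_nonneg _).trans (hC 0)
  have hD0 : 0 ≤ D := (norm_nonneg _).trans (hD 0)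
  by_cases hj : j = 0
  · rw [hj, norm_zero, add_zero, one_pow, one_mul]
    calc ‖fcoeff F 0‖ ≤ 1 * (C + D) := by rw [one_mul]; linarith [norm_fcoeff_le hC 0]
      _ ≤ _ := mul_le_mul_of_nonneg_right (one_le_pow₀ one_le_two) (by positivity)
  · obtain ⟨h, hn, hh⟩ := exists_norm_eq_chr_eq_neg_one hj
    have h1 := two_pow_mul_norm_fcoeff_le hh M F D hF hD
    have hj1 : 1 ≤ ‖j‖ := by
      by_contra hlt
      rw [not_le] at hlt
      refine hj (funext fun i => ?_)
      have h2 := (norm_le_pi_norm j i).trans_lt hlt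
      rw [Int.norm_eq_abs] at h2
      exact Int.abs_lt_one_iff.1 (by exact_mod_cast h2)
    calc (1 + ‖j‖) ^ M * ‖fcoeff F j‖ ≤ (2 * ‖j‖) ^ M * ‖fcoeff F j‖ := by gcongr; linarith
      _ ≤ (2 * ‖j‖) ^ M * (2 ^ M * ‖fcoeff F j‖) := by
          gcongr
          exact le_mul_of_one_le_left (norm_nonneg _) (one_le_pow₀ one_le_two)
      _ ≤ (2 * ‖j‖) ^ M * (‖h‖ ^ M * D) := by gcongr
      _ = D := by
          rw [hn, inv_pow, ← mul_assoc, mul_inv_cancel₀ (by positivity), one_mul]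
      _ ≤ 1 * (C + D) := by linarith
      _ ≤ _ := mul_le_mul_of_nonneg_right (one_le_pow₀ one_le_two) (by positivity)

/-- The Fourier coefficients of a Schwartz function in its torus variable. -/
def fourierZT (ψ : SchwartzZT n) (q : Zn n × Zn n) : ℂ := fcoeff (fun w => ψ.1 (q.1, w)) q.2

theorem exists_pow_mul_norm_fourierZT_le (ψ : SchwartzZT n) (M N : ℕ) :
    ∃ C : ℝ, ∀ q, (1 + ‖q.1‖) ^ M * ((1 + ‖q.2‖) ^ N * ‖fourierZT ψ q‖) ≤ C := by
  obtain ⟨C, hC⟩ := ψ.2.2 M 0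
  obtain ⟨D, hD⟩ := ψ.2.2 M N
  refine ⟨2 ^ N * (C + D), fun q => ?_⟩
  have hp : 0 < (1 + ‖q.1‖) ^ M := by positivity
  have h := one_add_pow_mul_norm_fcoeff_le (F := fun w => ψ.1 (q.1, w)) (M := N)
    (C := C / (1 + ‖q.1‖) ^ M) (D := D / (1 + ‖q.1‖) ^ M) (ψ.2.1 q.1)
    (fun w => by
      obtain ⟨x, rfl⟩ := exists_toTorus_eq w
      rw [le_div_iff₀' hp]
      have h0 := hC q.1 x
      rwa [norm_iteratedFDeriv_zero] at h0)
    (fun x => by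
      rw [le_div_iff₀' hp]
      exact hD q.1 x) q.2
  calc _ ≤ (1 + ‖q.1‖) ^ M * (2 ^ N * (C / (1 + ‖q.1‖) ^ M + D / (1 + ‖q.1‖) ^ M)) :=
        mul_le_mul_of_nonneg_left h hp.le
    _ = _ := by field_simp

theorem summable_pow_mul_norm_fourierZT (ψ : SchwartzZT n) (M N : ℕ) :
    Summable fun q => (1 + ‖q.1‖) ^ M * ((1 + ‖q.2‖) ^ N * ‖fourierZT ψ q‖) := by
  -- The `2 * n` spare powers in each variable pay for summability over `ℤⁿ × ℤⁿ`.
  obtain ⟨C, hC⟩ := exists_pow_mul_norm_fourierZT_le ψ (M + 2 * n) (N + 2 * n)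
  refine Summable.of_nonneg_of_le (fun q => by positivity) (fun q => ?_)
    (((summable_inv_pow n).mul_of_nonneg (summable_inv_pow n) (fun q => by positivity)
      (fun q => by positivity)).mul_left C)
  have h1 : 0 < (1 + ‖q.1‖) ^ (2 * n) := by positivity
  have h2 : 0 < (1 + ‖q.2‖) ^ (2 * n) := by positivity
  rw [← mul_inv, ← div_eq_mul_inv, le_div_iff₀ (by positivity)]
  calc _ = _ := by ring
    _ ≤ C := hC q

theorem summable_norm_fourierZT (ψ : SchwartzZT n) : Summable fun q => ‖fourierZT ψ q‖ := by
  simpa using summable_pow_mul_norm_fourierZT ψ 0 0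

theorem continuous_slice (ψ : SchwartzZT n) (m : Zn n) : Continuous fun w => ψ.1 (m, w) :=
  continuous_of_toTorus (ψ.2.1 m).continuous

theorem hasSum_fourierZT (ψ : SchwartzZT n) (m : Zn n) (w : Tn n) :
    HasSum (fun j => fourierZT ψ (m, j) * chr j w) (ψ.1 (m, w)) := by
  have hs : Summable fun j => fourierZT ψ (m, j) :=
    ((summable_norm_fourierZT ψ).comp_injective
      (i := fun j : Zn n => (m, j)) fun a b h => (Prod.ext_iff.1 h).2).of_norm
  exact UnitAddTorus.hasSum_mFourier_series_apply_of_summable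
    (f := ⟨fun w => ψ.1 (m, w), continuous_slice ψ m⟩) hs w

/-- The derivatives of a character, bounded polynomially in its frequency. -/
theorem norm_iteratedFDeriv_chr_le (l : Zn n) (i : ℕ) (x : Fin n → ℝ) :
    ‖iteratedFDeriv ℝ i (fun x => chr l (toTorus x)) x‖
      ≤ ((2 * Real.pi * (n + 1)) * (1 + ‖l‖)) ^ i := by
  -- The character is `t ↦ e^{2πit}` composed with the linear functional `x ↦ l·x`, so its `i`-th
  -- derivative has norm at most `(2π‖g‖)^i`.
  let g : (Fin n → ℝ) →L[ℝ] ℝ := ∑ r, (l r : ℝ) • ContinuousLinearMap.proj r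
  let f : ℝ → ℂ := fun t => Complex.exp (2 * Real.pi * Complex.I * t)
  have hfg : (fun x => chr l (toTorus x)) = f ∘ g := by
    funext x
    simp only [Function.comp, f, g, chr_toTorus, sum_apply, smul_apply,
      ContinuousLinearMap.proj_apply, smul_eq_mul]
  have hf : ContDiff ℝ ∞ f := (contDiff_const.mul Complex.ofRealCLM.contDiff).cexp
  have hder : ∀ i : ℕ, iteratedDeriv i f = fun t => (2 * Real.pi * Complex.I) ^ i * f t := by
    intro i
    induction i with
    | zero => funext t; simp
    | succ i ih =>
      rw [iteratedDeriv_succ, ih]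
      funext t
      have h : HasDerivAt f (f t * (2 * Real.pi * Complex.I * 1)) t :=
        (((Complex.ofRealCLM.hasDerivAt (x := t)).const_mul (2 * Real.pi * Complex.I)).cexp)
      rw [(h.const_mul _).deriv]
      ring
  -- Weaker than `n * ‖l‖` on purpose: it keeps the base of the final bound at least 1, even for `n
  -- = 0`, so that exponents can later be raised.
  have hg : ‖g‖ ≤ (n + 1) * (1 + ‖l‖) := by
    calc ‖g‖ ≤ ∑ r : Fin n, ‖l‖ := by
          refine (norm_sum_le _ _).trans (Finset.sum_le_sum fun r _ => ?_)
          rw [norm_smul, Real.norm_eq_abs, ← Int.norm_eq_abs]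
          refine (mul_le_of_le_one_right (norm_nonneg _) ?_).trans (norm_le_pi_norm l r)
          exact ContinuousLinearMap.opNorm_le_bound _ zero_le_one fun x => by
            rw [one_mul]; exact norm_le_pi_norm x r
      _ = n * ‖l‖ := by simp
      _ ≤ _ := by nlinarith [norm_nonneg l, Nat.cast_nonneg (α := ℝ) n]
  have hi : ((i : ℕ∞) : WithTop ℕ∞) ≤ ∞ := by exact_mod_cast le_top
  rw [hfg, g.iteratedFDeriv_comp_right hf x hi]
  refine (ContinuousMultilinearMap.norm_compContinuousLinearMap_le _ _).trans ?_
  rw [Finset.prod_const, Finset.card_univ, Fintype.card_fin,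
    norm_iteratedFDeriv_eq_norm_iteratedDeriv, hder, norm_mul, norm_pow]
  have h1 : ‖f (g x)‖ = 1 := by
    have : f (g x) = chr l (toTorus x) := (congrFun hfg x).symm
    rw [this, norm_chr]
  have h2 : ‖(2 * Real.pi * Complex.I : ℂ)‖ = 2 * Real.pi := by
    simp [abs_of_pos Real.pi_pos]
  rw [h1, h2, mul_one, ← mul_pow]
  have := Real.pi_pos
  refine pow_le_pow_left₀ (by positivity) ?_ i
  calc 2 * Real.pi * ‖g‖ ≤ 2 * Real.pi * ((n + 1) * (1 + ‖l‖)) := by gcongr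
    _ = _ := by ring

/-- The function `δ_k ⊗ e_j` on `ℤⁿ × 𝕋ⁿ`, where `e_j(w) = e^{2πi w·j}`. -/
def tensorZT (k j : Zn n) : SchwartzZT n :=
  ⟨fun z => if z.1 = k then chr j z.2 else 0, by
    have h0 : ∀ m : Zn n, lift (fun z : Zn n × Tn n => if z.1 = k then chr j z.2 else 0) m
        = if m = k then fun x => chr j (toTorus x) else fun _ => 0 := fun m => by
      split_ifs with h
      · funext x; simp only [lift, h, if_true]; rfl
      · funext x; simp [lift, h]
    refine ⟨fun m => ?_, fun M i => ⟨(1 + ‖k‖) ^ M *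
      (((2 * Real.pi * (n + 1)) * (1 + ‖j‖)) ^ i), fun m x => ?_⟩⟩
    · rw [h0]
      split_ifs
      · exact contDiff_chr j
      · exact contDiff_const
    · have hpos : 0 ≤ ((2 * Real.pi * (n + 1)) * (1 + ‖j‖)) ^ i := by
        have := Real.pi_pos
        positivity
      rw [h0]
      split_ifs with h
      · rw [h]
        gcongr
        exact norm_iteratedFDeriv_chr_le j i x
      · rw [iteratedFDeriv_fun_zero, Pi.zero_apply, norm_zero, mul_zero]
        positivity⟩

theorem tensorZT_apply (k j : Zn n) (z : Zn n × Tn n) :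
    (tensorZT k j).1 z = if z.1 = k then chr j z.2 else 0 := rfl

/-! ### Convergence of the Fourier series in the Schwartz seminorms. -/

theorem lift_tensorZT_self (k j : Zn n) :
    lift (tensorZT k j).1 k = fun x => chr j (toTorus x) := by
  funext x; simp only [lift, tensorZT_apply, if_true]; rfl

theorem lift_tensorZT_of_ne {k m : Zn n} (h : m ≠ k) (j : Zn n) :
    lift (tensorZT k j).1 m = fun _ => 0 := by
  funext x; simp [lift, tensorZT_apply, h]

theorem norm_iteratedFDeriv_tensorZT_le (k j m : Zn n) (i : ℕ) (x : Fin n → ℝ) :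
    ‖iteratedFDeriv ℝ i (lift (tensorZT k j).1 m) x‖ ≤
      if m = k then ((2 * Real.pi * (n + 1)) * (1 + ‖j‖)) ^ i else 0 := by
  split_ifs with h
  · rw [h, lift_tensorZT_self]
    exact norm_iteratedFDeriv_chr_le j i x
  · rw [lift_tensorZT_of_ne h, iteratedFDeriv_fun_zero, Pi.zero_apply, norm_zero]

theorem hasSum_fourierZT_tensorZT (ψ : SchwartzZT n) (z : Zn n × Tn n) :
    HasSum (fun q : Zn n × Zn n => fourierZT ψ q * (tensorZT q.1 q.2).1 z) (ψ.1 z) := by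
  have hinj : Function.Injective fun j : Zn n => (z.1, j) := fun a b h => (Prod.ext_iff.1 h).2
  refine (hinj.hasSum_iff fun q hq => ?_).1 ?_
  · have : z.1 ≠ q.1 := fun h => hq ⟨q.2, by rw [h]⟩
    rw [tensorZT_apply, if_neg this, mul_zero]
  · convert hasSum_fourierZT ψ z.1 z.2 using 1
    funext j
    simp [tensorZT_apply]

/-- The seminorms of the tail of the Fourier series of a Schwartz function. -/
theorem seminorm_tail_le (ψ : SchwartzZT n) (N : ℕ) (s : Finset (Zn n × Zn n)) {M i : ℕ}
    (hM : M ≤ N) (hi : i ≤ N) (m : Zn n) (x : Fin n → ℝ) :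
    (1 + ‖m‖) ^ M * ‖iteratedFDeriv ℝ i
      (lift (ψ - ∑ q ∈ s, fourierZT ψ q • tensorZT q.1 q.2).1 m) x‖ ≤
    ∑' q : {q // q ∉ s}, (1 + ‖q.1.1‖) ^ N *
      (((2 * Real.pi * (n + 1)) * (1 + ‖q.1.2‖)) ^ N * ‖fourierZT ψ q.1‖) := by
  have hK : 1 ≤ 2 * Real.pi * (n + 1) := by
    nlinarith [Real.pi_gt_three, Nat.cast_nonneg (α := ℝ) n]
  have hK1 : ∀ j : Zn n, 1 ≤ (2 * Real.pi * (n + 1)) * (1 + ‖j‖) := fun j =>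
    one_le_mul_of_one_le_of_one_le hK (by linarith [norm_nonneg j])
  have hB : ∀ i : ℕ, Summable fun q : Zn n × Zn n => (1 + ‖q.1‖) ^ N *
      (((2 * Real.pi * (n + 1)) * (1 + ‖q.2‖)) ^ i * ‖fourierZT ψ q‖) := fun i => by
    refine ((summable_pow_mul_norm_fourierZT ψ N i).mul_left
      ((2 * Real.pi * (n + 1)) ^ i)).congr fun q => ?_
    rw [mul_pow (2 * Real.pi * (n + 1)) (1 + ‖q.2‖) i]; ring
  have hlift : lift (ψ - ∑ q ∈ s, fourierZT ψ q • tensorZT q.1 q.2).1 m =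
      fun x => ∑' q : {q // q ∉ s}, (fourierZT ψ q.1 • lift (tensorZT q.1.1 q.1.2).1 m) x := by
    funext x
    have h := (hasSum_fourierZT_tensorZT ψ (m, toTorus x))
    have h1 := h.summable.sum_add_tsum_subtype_compl s
    rw [h.tsum_eq] at h1
    have h2 : lift (ψ - ∑ q ∈ s, fourierZT ψ q • tensorZT q.1 q.2).1 m x =
        ψ.1 (m, toTorus x) - ∑ q ∈ s, fourierZT ψ q * (tensorZT q.1 q.2).1 (m, toTorus x) := by
      simp only [lift, Submodule.coe_sub, Submodule.coe_sum, Submodule.coe_smul, Pi.sub_apply,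
        Finset.sum_apply, Pi.smul_apply, smul_eq_mul]
      rfl
    rw [h2, ← h1, add_sub_cancel_left]
    rfl
  have hsm : ∀ q : {q // q ∉ s}, ContDiff ℝ ∞
      (fourierZT ψ q.1 • lift (tensorZT q.1.1 q.1.2).1 m) := fun q =>
    ((tensorZT q.1.1 q.1.2).2.1 m).const_smul (fourierZT ψ q.1)
  let v : ℕ → {q // q ∉ s} → ℝ := fun i q =>
    ‖fourierZT ψ q.1‖ * if m = q.1.1 then ((2 * Real.pi * (n + 1)) * (1 + ‖q.1.2‖)) ^ i else 0
  have hle : ∀ (i : ℕ) (q : {q // q ∉ s}) (x : Fin n → ℝ), ‖iteratedFDeriv ℝ i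
      (fourierZT ψ q.1 • lift (tensorZT q.1.1 q.1.2).1 m) x‖ ≤ v i q := fun i q x => by
    have hi : ((i : ℕ∞) : WithTop ℕ∞) ≤ ∞ := by exact_mod_cast le_top
    rw [iteratedFDeriv_const_smul_apply (((tensorZT q.1.1 q.1.2).2.1 m).of_le hi).contDiffAt,
      norm_smul]
    exact mul_le_mul_of_nonneg_left (norm_iteratedFDeriv_tensorZT_le _ _ _ _ _) (norm_nonneg _)
  have hv0 : ∀ i q, 0 ≤ v i q := fun i q => (norm_nonneg _).trans (hle i q 0)
  -- Only terms with `q.1.1 = m` live on row `m`, so the weight in `m` may be replaced by one in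
  -- `q.1.1`; the bound then no longer depends on `m`.
  have hvB : ∀ i, ∀ q : {q // q ∉ s}, (1 + ‖m‖) ^ N * v i q ≤ (1 + ‖q.1.1‖) ^ N *
      (((2 * Real.pi * (n + 1)) * (1 + ‖q.1.2‖)) ^ i * ‖fourierZT ψ q.1‖) := fun i q => by
    have := (hK1 q.1.2).trans' zero_le_one
    by_cases h : m = q.1.1
    · simp only [v, h, if_true]
      exact le_of_eq (by ring)
    · simp only [v, if_neg h, mul_zero]
      positivity
  have hvs : ∀ i, Summable (v i) := fun i => by
    refine Summable.of_nonneg_of_le (hv0 i) (fun q => ?_) ((hB i).subtype {q | q ∉ s})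
    refine le_trans ?_ (hvB i q)
    exact le_mul_of_one_le_left (hv0 i q) (one_le_pow₀ (by linarith [norm_nonneg m]))
  have hit : iteratedFDeriv ℝ i
      (lift (ψ - ∑ q ∈ s, fourierZT ψ q • tensorZT q.1 q.2).1 m) x = ∑' q : {q // q ∉ s},
        iteratedFDeriv ℝ i (fourierZT ψ q.1 • lift (tensorZT q.1.1 q.1.2).1 m) x := by
    rw [hlift]
    exact iteratedFDeriv_tsum_apply (N := ⊤) hsm (fun k _ => hvs k)
      (fun k q x _ => hle k q x) le_top x
  rw [hit]
  calc (1 + ‖m‖) ^ M * ‖∑' q : {q // q ∉ s},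
        iteratedFDeriv ℝ i (fourierZT ψ q.1 • lift (tensorZT q.1.1 q.1.2).1 m) x‖
      ≤ (1 + ‖m‖) ^ N * ∑' q, v i q := by
        gcongr
        · linarith [norm_nonneg m]
        · exact tsum_of_norm_bounded (hvs i).hasSum fun q => hle i q x
    _ = ∑' q, (1 + ‖m‖) ^ N * v i q := tsum_mul_left.symm
    _ ≤ _ := by
        refine ((hvs i).mul_left _).tsum_le_tsum (fun q => (hvB i q).trans ?_)
          ((hB N).subtype {q | q ∉ s})
        gcongr
        exact hK1 q.1.2

/-- A tempered distribution is determined by its values on the functions `δ_k ⊗ e_j`. -/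
theorem IsTemperedZT.hasSum {σ : SchwartzZT n →ₗ[ℂ] ℂ} (hσ : IsTemperedZT σ)
    (ψ : SchwartzZT n) :
    HasSum (fun q : Zn n × Zn n => fourierZT ψ q * σ (tensorZT q.1 q.2)) (σ ψ) := by
  obtain ⟨N, C, hC⟩ := hσ
  -- This tail dominates every seminorm of order up to `N` of the remainder, so temperedness makes
  -- `σ` of the remainder tend to zero.
  have h0 := (tendsto_tsum_compl_atTop_zero fun q : Zn n × Zn n => (1 + ‖q.1‖) ^ N *
      (((2 * Real.pi * (n + 1)) * (1 + ‖q.2‖)) ^ N * ‖fourierZT ψ q‖)).const_mul C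
  rw [mul_zero] at h0
  rw [HasSum, SummationFilter.unconditional_filter, tendsto_iff_norm_sub_tendsto_zero]
  refine squeeze_zero (fun _ => norm_nonneg _) (fun s => ?_) h0
  have h1 : ‖∑ q ∈ s, fourierZT ψ q * σ (tensorZT q.1 q.2) - σ ψ‖ =
      ‖σ (ψ - ∑ q ∈ s, fourierZT ψ q • tensorZT q.1 q.2)‖ := by
    rw [norm_sub_rev, map_sub, map_sum]
    simp only [map_smul, smul_eq_mul]
  rw [h1]
  exact hC _ _ fun M hM i hi m x => seminorm_tail_le ψ N s hM hi m x

end FourierSeries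

/-! ### Integration on the phase space -/

section Measures

variable {n : ℕ}

theorem count_prod_count :
    (Measure.count.prod Measure.count : Measure (Zn n × Zn n)) = Measure.count := by
  refine Measure.ext_of_singleton fun q => ?_
  rw [← Set.singleton_prod_singleton, Measure.prod_prod, Set.singleton_prod_singleton]
  simp

/-- The discrete coordinates of a point of the phase space. -/
theorem measurePreserving_phase_discrete (q : Zn n × Zn n) :
    MeasurePreserving (fun z : (Zn n × Tn n) × (Tn n × Zn n) => q + (z.1.1, z.2.2))
      (haarPhase n) Measure.count := by
  have h : MeasurePreserving (Prod.map Prod.fst Prod.snd :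
      (Zn n × Tn n) × (Tn n × Zn n) → Zn n × Zn n) (haarPhase n)
        (Measure.count.prod Measure.count) :=
    (measurePreserving_fst (μ := Measure.count) (ν := haarT n)).prod
      (measurePreserving_snd (μ := haarT n) (ν := Measure.count))
  rw [count_prod_count] at h
  exact (measurePreserving_add_left Measure.count q).comp h

theorem lintegral_haarPhase {f : (Zn n × Tn n) × (Tn n × Zn n) → ENNReal} (hf : Measurable f) :
    ∫⁻ z, f z ∂haarPhase n = ∑' q : Zn n × Zn n,
      ∫⁻ v : Tn n × Tn n, f ((q.1, v.1), (v.2, q.2)) ∂(haarT n).prod (haarT n) := by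
  have h1 : ∀ m l, Measurable fun v : Tn n × Tn n => f ((m, v.1), (v.2, l)) := fun m l =>
    hf.comp (by fun_prop)
  have h2 : ∀ m w, ∫⁻ b, f ((m, w), b) ∂(haarT n).prod Measure.count =
      ∑' l, ∫⁻ x, f ((m, w), (x, l)) ∂haarT n := fun m w => by
    rw [lintegral_prod (fun b => f ((m, w), b)) (hf.comp (by fun_prop)).aemeasurable]
    simp only [lintegral_count]
    exact lintegral_tsum fun l => (hf.comp (by fun_prop)).aemeasurable
  rw [haarPhase, lintegral_prod _ hf.aemeasurable, haarZT,
    lintegral_prod _ hf.lintegral_prod_right'.aemeasurable, lintegral_count,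
    ENNReal.tsum_prod (f := fun m l =>
      ∫⁻ v : Tn n × Tn n, f ((m, v.1), (v.2, l)) ∂(haarT n).prod (haarT n))]
  congr 1
  funext m
  simp only [h2]
  rw [lintegral_tsum fun l => ?_]
  · congr 1
    funext l
    rw [lintegral_prod _ (h1 m l).aemeasurable]
  · exact (h1 m l).lintegral_prod_right'.aemeasurable

/-- For `j ≠ 0`, translation by a half period changes the sign of the character but not the
integral. -/
theorem integral_chr (j : Zn n) : ∫ w, chr j w ∂haarT n = if j = 0 then 1 else 0 := by
  split_ifs with h
  · simp [h, chr_zero]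
  · obtain ⟨x, -, hx⟩ := exists_norm_eq_chr_eq_neg_one h
    have h1 : ∫ w, chr j w ∂haarT n = -∫ w, chr j w ∂haarT n := by
      conv_lhs => rw [← integral_sub_right_eq_self (fun w => chr j w) (toTorus x)]
      rw [← integral_neg]
      congr 1
      funext w
      have h2 : chr j w = chr j (w - toTorus x) * chr j (toTorus x) := by
        rw [← chr_add, sub_add_cancel]
      have h3 : chr j (toTorus x) = -1 := by
        rw [← neg_neg j, chr_neg, hx]
        simp
      rw [h2, h3]
      ring
    exact self_eq_neg.1 h1

theorem integral_chr_mul_conj (k j : Zn n) :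
    ∫ w, chr k w * starRingEnd ℂ (chr j w) ∂haarT n = if j = k then 1 else 0 := by
  have h : ∀ w : Tn n, chr k w * starRingEnd ℂ (chr j w) = chr (k - j) w := fun w => by
    rw [sub_eq_add_neg, chr_add_left, chr_neg]
  simp only [h, integral_chr, sub_eq_zero, eq_comm]

/-- Minkowski's inequality for infinite sums. -/
theorem eLpNorm_tsum_le {α ι : Type*} [Countable ι] [MeasurableSpace α] {μ : Measure α}
    {p : ENNReal} (hp : 1 ≤ p) {F : ι → α → ℂ} {f : α → ℂ}
    (hF : ∀ i, AEStronglyMeasurable (F i) μ) (hf : ∀ x, HasSum (fun i => F i x) (f x)) :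
    eLpNorm f p μ ≤ ∑' i, eLpNorm (F i) p μ := by
  -- Fatou's lemma for `Lᵖ` norms needs a sequence, so partial sums are taken along a cofinal
  -- sequence of finite sets.
  obtain ⟨s, hs⟩ := Filter.exists_seq_tendsto (Filter.atTop : Filter (Finset ι))
  refine (Lp.eLpNorm_lim_le_liminf_eLpNorm (f := fun N => ∑ i ∈ s N, F i)
    (fun N => Finset.aestronglyMeasurable_sum _ fun i _ => hF i) f
    (Filter.Eventually.of_forall fun x => ?_)).trans ?_
  · have h := (hf x).comp hs
    simpa [Function.comp_def] using h
  · refine Filter.liminf_le_of_frequently_le' (Filter.Frequently.of_forall fun N => ?_)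
    exact (eLpNorm_sum_le (fun i _ => hF i) hp).trans (ENNReal.sum_le_tsum _)

end Measures

/-! ### The modulation spaces in terms of Fourier coefficients -/

section Modulation

variable {n : ℕ}

/-- The Fourier coefficients of a distribution on `ℤⁿ × 𝕋ⁿ`. -/
def coeffZT (σ : SchwartzZT n →ₗ[ℂ] ℂ) (q : Zn n × Zn n) : ℂ := σ (tensorZT q.1 (-q.2))

theorem coeffZT_sub (σ τ : SchwartzZT n →ₗ[ℂ] ℂ) : coeffZT (σ - τ) = coeffZT σ - coeffZT τ :=
  rfl

theorem IsTemperedZT.sub {σ τ : SchwartzZT n →ₗ[ℂ] ℂ} (hσ : IsTemperedZT σ)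
    (hτ : IsTemperedZT τ) : IsTemperedZT (σ - τ) := by
  obtain ⟨N, C, hC⟩ := hσ
  obtain ⟨N', C', hC'⟩ := hτ
  refine ⟨max N N', C + C', fun φ b h => ?_⟩
  rw [LinearMap.sub_apply, add_mul]
  exact (norm_sub_le _ _).trans (add_le_add
    (hC φ b fun M hM j hj => h M (hM.trans (le_max_left _ _)) j (hj.trans (le_max_left _ _)))
    (hC' φ b fun M hM j hj => h M (hM.trans (le_max_right _ _)) j (hj.trans (le_max_right _ _))))

/-- The discrete shifts `m` and `l` move the indices of the coefficients, conjugation negates the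
frequency, and the torus parameters `w` and `x` contribute only unimodular factors. These factors
are the characters of the series for `V_Φ σ`. -/
theorem fourierZT_timeFrequencyShift (Φ : SchwartzZT n) (m l : Zn n) (w x : Tn n)
    (q : Zn n × Zn n) :
    fourierZT (conjZT (modulateZT (x, l) (translateZT (m, w) Φ))) (q.1 + m, -(q.2 + l)) =
      starRingEnd ℂ (fourierZT Φ q) * (starRingEnd ℂ (chr (q.1 + m) x) * chr q.2 w) := by
  have h1 : fourierZT (conjZT (modulateZT (x, l) (translateZT (m, w) Φ))) (q.1 + m, -(q.2 + l)) =
      ∫ v, starRingEnd ℂ (chr (q.1 + m) x * (chr (-q.2) v * Φ.1 (q.1, v - w))) ∂haarT n := by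
    rw [fourierZT, fcoeff]
    congr 1
    funext v
    change chr (- -(q.2 + l)) v * starRingEnd ℂ (chr (q.1 + m) x * chr l v *
      Φ.1 ((q.1 + m, v) - (m, w))) = _
    have h2 : chr l v * starRingEnd ℂ (chr l v) = 1 := by
      rw [Complex.mul_conj, Complex.normSq_eq_norm_sq, norm_chr]
      simp
    rw [neg_neg, chr_add_left, Prod.mk_sub_mk, add_sub_cancel_right, chr_neg]
    simp only [map_mul, Complex.conj_conj]
    linear_combination (chr q.2 v * starRingEnd ℂ (chr (q.1 + m) x) *
      starRingEnd ℂ (Φ.1 (q.1, v - w))) * h2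
  rw [h1, integral_conj, integral_const_mul, map_mul]
  have h3 : ∫ v, chr (-q.2) v * Φ.1 (q.1, v - w) ∂haarT n = chr (-q.2) w * fourierZT Φ q :=
    fcoeff_translate (fun v => Φ.1 (q.1, v)) w q.2
  rw [h3, map_mul, chr_neg, Complex.conj_conj]
  ring

/-- The function `V` on the phase space is given by the Fourier series with coefficients
`conj (a(q)) c(q + (m, l))`. -/
def IsPhaseSeries (a c : Zn n × Zn n → ℂ) (V : (Zn n × Tn n) × (Tn n × Zn n) → ℂ) : Prop :=
  ∀ m l w x, HasSum (fun q : Zn n × Zn n => (starRingEnd ℂ (a q) * c (q + (m, l))) *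
    (starRingEnd ℂ (chr (q.1 + m) x) * chr q.2 w)) (V ((m, w), (x, l)))

theorem norm_conj_chr_mul_chr (k j : Zn n) (x w : Tn n) :
    ‖starRingEnd ℂ (chr k x) * chr j w‖ = 1 := by
  rw [norm_mul, RCLike.norm_conj, norm_chr, norm_chr, one_mul]

theorem continuous_conj_chr_mul_chr (k j : Zn n) :
    Continuous fun v : Tn n × Tn n => starRingEnd ℂ (chr k v.2) * chr j v.1 :=
  (Complex.continuous_conj.comp ((continuous_chr k).comp continuous_snd)).mul
    ((continuous_chr j).comp continuous_fst)

theorem IsPhaseSeries.summable {a c : Zn n × Zn n → ℂ}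
    {V : (Zn n × Tn n) × (Tn n × Zn n) → ℂ} (hV : IsPhaseSeries a c V) (m l : Zn n) :
    Summable fun q : Zn n × Zn n =>
      ‖starRingEnd ℂ (a q) * c (q + (m, l))‖ := by
  -- In `ℂ` unconditional convergence is absolute, and the phases have modulus 1; one base point
  -- therefore suffices.
  refine (hV m l 0 0).summable.norm.congr fun q => ?_
  rw [norm_mul (starRingEnd ℂ (a q) * c (q + (m, l))), norm_conj_chr_mul_chr,
    mul_one]

theorem IsPhaseSeries.measurable {a c : Zn n × Zn n → ℂ}
    {V : (Zn n × Tn n) × (Tn n × Zn n) → ℂ} (hV : IsPhaseSeries a c V) : Measurable (V) := by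
  have h1 : ∀ m l, Continuous fun v : Tn n × Tn n => V ((m, v.1), (v.2, l)) :=
    fun m l => by
      have h2 : (fun v : Tn n × Tn n => V ((m, v.1), (v.2, l))) = fun v =>
          ∑' q : Zn n × Zn n, (starRingEnd ℂ (a q) * c (q + (m, l))) *
            (starRingEnd ℂ (chr (q.1 + m) v.2) * chr q.2 v.1) := by
        funext v
        exact (hV m l v.1 v.2).tsum_eq.symm
      rw [h2]
      refine continuous_tsum (fun q => continuous_const.mul (continuous_conj_chr_mul_chr _ _))
        (hV.summable m l) fun q v => ?_
      rw [norm_mul (starRingEnd ℂ (a q) * c (q + (m, l))),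
        norm_conj_chr_mul_chr, mul_one]
  have h3 : Measurable fun y : (Zn n × Zn n) × (Tn n × Tn n) =>
      V ((y.1.1, y.2.1), (y.2.2, y.1.2)) :=
    measurable_from_prod_countable_right fun q => (h1 q.1 q.2).measurable
  exact h3.comp (g := fun y => V ((y.1.1, y.2.1), (y.2.2, y.1.2)))
    (f := fun z : (Zn n × Tn n) × (Tn n × Zn n) => ((z.1.1, z.2.2), (z.1.2, z.2.1)))
    (by fun_prop)

/-- The modulation norm is bounded by the `ℓᵖ` norm of the Fourier coefficients. -/
theorem IsPhaseSeries.eLpNorm_le {a c : Zn n × Zn n → ℂ}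
    {V : (Zn n × Tn n) × (Tn n × Zn n) → ℂ} (hV : IsPhaseSeries a c V) {p : ENNReal} (hp : 1 ≤ p) :
    eLpNorm (V) p (haarPhase n) ≤
      (∑' q, ‖a q‖ₑ) * eLpNorm (c) p Measure.count := by
  have hc : ∀ q : Zn n × Zn n, Measurable fun z : (Zn n × Tn n) × (Tn n × Zn n) =>
      c (q + (z.1.1, z.2.2)) := fun q =>
    (measurable_of_countable (c)).comp (measurePreserving_phase_discrete q).measurable
  have hχ : ∀ q : Zn n × Zn n, Measurable fun z : (Zn n × Tn n) × (Tn n × Zn n) =>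
      starRingEnd ℂ (chr (q.1 + z.1.1) z.2.1) * chr q.2 z.1.2 := fun q => by
    have h : Measurable fun y : Zn n × (Tn n × Tn n) =>
        starRingEnd ℂ (chr (q.1 + y.1) y.2.2) * chr q.2 y.2.1 :=
      measurable_from_prod_countable_right fun m =>
        (continuous_conj_chr_mul_chr (q.1 + m) q.2).measurable
    exact h.comp (f := fun z : (Zn n × Tn n) × (Tn n × Zn n) => (z.1.1, (z.1.2, z.2.1)))
      (by fun_prop)
  let F : Zn n × Zn n → (Zn n × Tn n) × (Tn n × Zn n) → ℂ := fun q z =>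
    (starRingEnd ℂ (a q) * c (q + (z.1.1, z.2.2))) *
      (starRingEnd ℂ (chr (q.1 + z.1.1) z.2.1) * chr q.2 z.1.2)
  have hF : ∀ q, Measurable (F q) := fun q =>
    Measurable.mul (Measurable.const_mul (hc q) (starRingEnd ℂ (a q))) (hχ q)
  have hVF : ∀ z, HasSum (fun q => F q z) (V z) := fun z => hV z.1.1 z.2.2 z.1.2 z.2.1
  refine (eLpNorm_tsum_le hp (fun q => (hF q).aestronglyMeasurable) hVF).trans ?_
  rw [← ENNReal.tsum_mul_right]
  refine ENNReal.tsum_le_tsum fun q => le_of_eq ?_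
  -- The `q`-th term has modulus `|a(q)| |c(q + (m, l))|`. As the torus factors have mass 1, its
  -- norm over phase space is `|a(q)|` times the `ℓᵖ` norm of `c`.
  have h1 := eLpNorm_comp_measurePreserving (p := p)
    (measurable_of_countable c).aestronglyMeasurable (measurePreserving_phase_discrete q)
  rw [← h1, ← RCLike.enorm_conj (a q), ← eLpNorm_const_smul]
  refine eLpNorm_congr_norm_ae (Filter.Eventually.of_forall fun z => ?_)
  simp only [Pi.smul_apply, Function.comp_apply, smul_eq_mul, F]
  rw [norm_mul (starRingEnd ℂ (a q) * c _), norm_conj_chr_mul_chr, mul_one]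

/-- On the torus fibre over `q`, the number `conj(a(r)) c(r + q)` is a Fourier coefficient of `V`,
hence at most the `L¹` norm there. -/
theorem IsPhaseSeries.enorm_coeff_le {a c : Zn n × Zn n → ℂ}
    {V : (Zn n × Tn n) × (Tn n × Zn n) → ℂ} (hV : IsPhaseSeries a c V) (q r : Zn n × Zn n) :
    ‖a r‖ₑ * ‖c (r + q)‖ₑ ≤
      ∫⁻ v : Tn n × Tn n, ‖V ((q.1, v.1), (v.2, q.2))‖ₑ
        ∂(haarT n).prod (haarT n) := by
  have hv : Continuous fun v : Tn n × Tn n =>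
      chr (r.1 + q.1) v.2 * starRingEnd ℂ (chr r.2 v.1) :=
    ((continuous_chr _).comp continuous_snd).mul
      (Complex.continuous_conj.comp ((continuous_chr _).comp continuous_fst))
  have hvi : Integrable (fun v : Tn n × Tn n =>
      chr (r.1 + q.1) v.2 * starRingEnd ℂ (chr r.2 v.1)) ((haarT n).prod (haarT n)) :=
    hv.integrable_of_hasCompactSupport (HasCompactSupport.of_compactSpace _)
  have hv1 : ∀ v : Tn n × Tn n, ‖chr (r.1 + q.1) v.2 * starRingEnd ℂ (chr r.2 v.1)‖ = 1 :=
    fun v => by rw [norm_mul, RCLike.norm_conj, norm_chr, norm_chr, one_mul]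
  have h := hasSum_integral_mul_of_summable hvi
    (χ := fun (s : Zn n × Zn n) v => starRingEnd ℂ (chr (s.1 + q.1) v.2) * chr s.2 v.1)
    (fun s => (continuous_conj_chr_mul_chr (s.1 + q.1) s.2).aestronglyMeasurable)
    (fun s v => (norm_conj_chr_mul_chr _ _ _ _).le) (hV.summable q.1 q.2)
  have hint : ∀ s : Zn n × Zn n, ∫ v : Tn n × Tn n,
      chr (r.1 + q.1) v.2 * starRingEnd ℂ (chr r.2 v.1) *
        (starRingEnd ℂ (chr (s.1 + q.1) v.2) * chr s.2 v.1) ∂(haarT n).prod (haarT n) =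
      if s = r then 1 else 0 := fun s => by
    have h1 : ∀ v : Tn n × Tn n, chr (r.1 + q.1) v.2 * starRingEnd ℂ (chr r.2 v.1) *
        (starRingEnd ℂ (chr (s.1 + q.1) v.2) * chr s.2 v.1) =
        (chr s.2 v.1 * starRingEnd ℂ (chr r.2 v.1)) *
          (chr (r.1 + q.1) v.2 * starRingEnd ℂ (chr (s.1 + q.1) v.2)) := fun v => by ring
    simp only [h1]
    rw [integral_prod_mul (fun w => chr s.2 w * starRingEnd ℂ (chr r.2 w))
      (fun x => chr (r.1 + q.1) x * starRingEnd ℂ (chr (s.1 + q.1) x)),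
      integral_chr_mul_conj, integral_chr_mul_conj]
    simp only [add_left_inj, Prod.ext_iff, eq_comm (a := r.2)]
    split_ifs <;> simp_all
  simp only [hint, mul_ite, mul_one, mul_zero] at h
  have h2 := h.unique (hasSum_single r fun s hs => if_neg hs)
  rw [if_pos rfl] at h2
  have h3 : ∀ v : Tn n × Tn n, ∑' s : Zn n × Zn n,
      (starRingEnd ℂ (a s) * c (s + (q.1, q.2))) *
        (starRingEnd ℂ (chr (s.1 + q.1) v.2) * chr s.2 v.1) =
      V ((q.1, v.1), (v.2, q.2)) := fun v =>
    (hV q.1 q.2 v.1 v.2).tsum_eq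
  simp only [h3] at h2
  rw [← RCLike.enorm_conj, ← enorm_mul, ← h2]
  refine (enorm_integral_le_lintegral_enorm _).trans (lintegral_mono fun v => ?_)
  rw [enorm_mul, ← ofReal_norm, hv1, ENNReal.ofReal_one, one_mul]

/-- The `ℓᵖ` norm of the Fourier coefficients is bounded by the modulation norm. -/
theorem IsPhaseSeries.eLpNorm_coeff_le {a c : Zn n × Zn n → ℂ}
    {V : (Zn n × Tn n) × (Tn n × Zn n) → ℂ} (hV : IsPhaseSeries a c V) (r : Zn n × Zn n) {p : ENNReal} (hp1 : 1 ≤ p) (hp : p ≠ ⊤) :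
    ‖a r‖ₑ * eLpNorm (c) p Measure.count ≤
      eLpNorm (V) p (haarPhase n) := by
  have hp0 : p ≠ 0 := (zero_lt_one.trans_le hp1).ne'
  have hpos : 0 < p.toReal := ENNReal.toReal_pos hp0 hp
  have hmeas := hV.measurable
  rw [← eLpNorm_comp_measurePreserving (g := c)
    (measurable_of_countable (c)).aestronglyMeasurable
    (measurePreserving_add_left Measure.count r), ← eLpNorm_const_smul,
    eLpNorm_eq_lintegral_rpow_enorm_toReal hp0 hp, eLpNorm_eq_lintegral_rpow_enorm_toReal hp0 hp,
    lintegral_count, lintegral_haarPhase (hmeas.enorm.pow_const _)]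
  gcongr with q
  have hq : Measurable fun v : Tn n × Tn n => V ((q.1, v.1), (v.2, q.2)) :=
    hmeas.comp (by fun_prop)
  -- Each torus fibre is a probability space, so its `L¹` norm is at most its `Lᵖ` norm.
  have h1 := eLpNorm_le_eLpNorm_of_exponent_le (μ := (haarT n).prod (haarT n)) hp1
    hq.aestronglyMeasurable
  rw [eLpNorm_one_eq_lintegral_enorm, eLpNorm_eq_lintegral_rpow_enorm_toReal hp0 hp, one_div,
    ENNReal.le_rpow_inv_iff hpos] at h1
  refine le_trans ?_ h1
  gcongr
  refine le_trans (le_of_eq ?_) (hV.enorm_coeff_le q r)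
  rw [← enorm_mul]
  rfl

/-- The short-time Fourier transform in terms of Fourier coefficients. -/
theorem IsTemperedZT.isPhaseSeries_stftZT {σ : SchwartzZT n →ₗ[ℂ] ℂ} (hσ : IsTemperedZT σ)
    (Φ : SchwartzZT n) :
    IsPhaseSeries (fourierZT Φ) (coeffZT σ) (stftZT Φ σ) := by
  intro m l w x
  have h := hσ.hasSum (conjZT (modulateZT (x, l) (translateZT (m, w) Φ)))
  let e : Zn n × Zn n ≃ Zn n × Zn n := (Equiv.addRight m).prodCongr
    ((Equiv.addRight l).trans (Equiv.neg _))
  convert e.hasSum_iff.2 h using 1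
  swap
  · rfl
  funext q
  symm
  change fourierZT (conjZT (modulateZT (x, l) (translateZT (m, w) Φ)))
    (q.1 + m, -(q.2 + l)) * σ (tensorZT (q.1 + m) (-(q.2 + l))) = _
  rw [fourierZT_timeFrequencyShift, coeffZT, Prod.fst_add, Prod.snd_add]
  ring

theorem exists_fourierZT_ne_zero {Φ : SchwartzZT n} (hΦ : Φ ≠ 0) : ∃ r, fourierZT Φ r ≠ 0 := by
  by_contra! h
  refine hΦ (Subtype.ext (funext fun z => ?_))
  have h1 := hasSum_fourierZT Φ z.1 z.2
  simp only [h, zero_mul] at h1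
  exact h1.unique hasSum_zero

theorem enorm_le_eLpNorm_count {α : Type*} [MeasurableSpace α] [MeasurableSingletonClass α]
    {p : ENNReal} (hp0 : p ≠ 0) (hp : p ≠ ⊤) (f : α → ℂ) (a : α) :
    ‖f a‖ₑ ≤ eLpNorm f p Measure.count := by
  rw [eLpNorm_eq_lintegral_rpow_enorm_toReal hp0 hp, lintegral_count, one_div,
    ENNReal.le_rpow_inv_iff (ENNReal.toReal_pos hp0 hp)]
  exact ENNReal.le_tsum (f := fun a => ‖f a‖ₑ ^ p.toReal) a

end Modulation

/-! ### Windows -/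

section Windows

variable {n : ℕ}

theorem one_add_norm_le (k m : Zn n) : 1 + ‖k‖ ≤ (1 + ‖m‖) * (1 + ‖k - m‖) := by
  have : ‖k‖ ≤ ‖k - m‖ + ‖m‖ := by simpa using norm_add_le (k - m) m
  nlinarith [norm_nonneg m, norm_nonneg (k - m)]

theorem summable_norm_mul_translate {φ g : Zn n → ℂ} (hφ : IsSchwartzZ φ) (hg : IsTemperedZ g)
    (m : Zn n) : Summable fun k => ‖g k * starRingEnd ℂ (φ (k - m))‖ := by
  obtain ⟨M, C, hC⟩ := hg
  -- `M` powers absorb the growth of `g`; the other `2 * n` give summability.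
  obtain ⟨D, hD⟩ := hφ (M + 2 * n)
  have hC0 : 0 ≤ C := by
    have h := (norm_nonneg _).trans (hC 0)
    simpa using h
  refine Summable.of_nonneg_of_le (fun k => norm_nonneg _) (fun k => ?_)
    (((Equiv.subRight m).summable_iff.2 (summable_inv_pow n)).mul_left (C * (1 + ‖m‖) ^ M * D))
  have hp : 0 < (1 + ‖k - m‖) ^ (2 * n) := by positivity
  simp only [Function.comp, Equiv.subRight_apply]
  rw [norm_mul, RCLike.norm_conj, ← div_eq_mul_inv, le_div_iff₀ hp]
  calc ‖g k‖ * ‖φ (k - m)‖ * (1 + ‖k - m‖) ^ (2 * n)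
      ≤ (C * ((1 + ‖m‖) * (1 + ‖k - m‖)) ^ M) * ‖φ (k - m)‖ * (1 + ‖k - m‖) ^ (2 * n) := by
        gcongr
        exact (hC k).trans (by gcongr; exact one_add_norm_le k m)
    _ = C * (1 + ‖m‖) ^ M * ((1 + ‖k - m‖) ^ (M + 2 * n) * ‖φ (k - m)‖) := by
        rw [mul_pow]; ring
    _ ≤ C * (1 + ‖m‖) ^ M * D := by
        gcongr
        exact hD _

/-- In the variable `w`, `V_φ g(m, ·)` is a Fourier series, and `g(k₀ + m) conj(φ(k₀))` is one of
its coefficients. -/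
theorem enorm_mul_le_lintegral_stftZ {φ g : Zn n → ℂ} (hφ : IsSchwartzZ φ)
    (hg : IsTemperedZ g) (k₀ m : Zn n) :
    ‖g (k₀ + m)‖ₑ * ‖φ k₀‖ₑ ≤ ∫⁻ w, ‖stftZ φ g (m, w)‖ₑ ∂haarT n := by
  have hconj : ∀ k, Continuous fun w : Tn n => starRingEnd ℂ (chr k w) := fun k =>
    Complex.continuous_conj.comp (continuous_chr k)
  have h := hasSum_integral_mul_of_summable
    (integrable_of_continuous (continuous_chr (k₀ + m)))
    (χ := fun (k : Zn n) (w : Tn n) => starRingEnd ℂ (chr k w))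
    (fun k => (hconj k).aestronglyMeasurable)
    (fun k w => by rw [RCLike.norm_conj, norm_chr]) (summable_norm_mul_translate hφ hg m)
  simp only [integral_chr_mul_conj, mul_ite, mul_one, mul_zero] at h
  have h2 := h.unique (hasSum_single (k₀ + m) fun s hs => if_neg hs)
  rw [if_pos rfl, add_sub_cancel_right] at h2
  have h3 : ∀ w, ∑' k, g k * starRingEnd ℂ (φ (k - m)) * starRingEnd ℂ (chr k w) =
      stftZ φ g (m, w) := fun w => by
    rw [stftZ]
    congr 1
    funext k
    rw [shiftZ, map_mul]
    ring
  simp only [h3] at h2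
  rw [← RCLike.enorm_conj (φ k₀), ← enorm_mul, ← h2]
  refine (enorm_integral_le_lintegral_enorm _).trans (lintegral_mono fun w => ?_)
  rw [enorm_mul, ← ofReal_norm, norm_chr, ENNReal.ofReal_one, one_mul]

/-- `M¹(ℤⁿ) ⊆ ℓ¹(ℤⁿ)`. -/
theorem summable_of_memModulationZ {φ g : Zn n → ℂ} (hφ : IsSchwartzZ φ) (hφ0 : φ ≠ 0)
    (hg : MemModulationZ φ 1 g) : Summable fun k => ‖g k‖ := by
  obtain ⟨k₀, hk₀⟩ := Function.ne_iff.1 hφ0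
  have h1 : ∑' m, ‖g (k₀ + m)‖ₑ * ‖φ k₀‖ₑ < ⊤ := by
    have h2 : eLpNorm (stftZ φ g) 1 (haarZT n) < ⊤ := hg.2.2
    rw [eLpNorm_one_eq_lintegral_enorm, haarZT,
      lintegral_prod _ hg.2.1.enorm, lintegral_count] at h2
    exact (ENNReal.tsum_le_tsum fun m =>
      enorm_mul_le_lintegral_stftZ hφ hg.1 k₀ m).trans_lt h2
  rw [ENNReal.tsum_mul_right, ENNReal.mul_lt_top_iff] at h1
  have h3 : ‖φ k₀‖ₑ ≠ 0 := enorm_ne_zero.2 hk₀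
  have h4 : ∑' m, ‖g (k₀ + m)‖ₑ ≠ ⊤ := by
    rcases h1 with h | h | h
    · exact h.1.ne
    · rw [h]; exact ENNReal.zero_ne_top
    · exact absurd h h3
  exact (Equiv.addLeft k₀).summable_iff.1 (tsum_enorm_ne_top_iff_summable_norm.1 h4)

end Windows

/-! ### Distributions with summable Fourier coefficients -/

section Regular

variable {n : ℕ}

theorem measurable_schwartzZT (φ : SchwartzZT n) : Measurable φ.1 :=
  measurable_from_prod_countable_right fun m => (continuous_slice φ m).measurable

theorem norm_schwartzZT_le {φ : SchwartzZT n} {b : ℝ}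
    (h : ∀ m x, ‖iteratedFDeriv ℝ 0 (lift φ.1 m) x‖ ≤ b) (z : Zn n × Tn n) : ‖φ.1 z‖ ≤ b := by
  obtain ⟨x, hx⟩ := exists_toTorus_eq z.2
  have h0 := h z.1 x
  rw [norm_iteratedFDeriv_zero] at h0
  have h1 : lift φ.1 z.1 x = φ.1 z := congrArg (fun w => φ.1 (z.1, w)) hx
  rwa [h1] at h0

theorem exists_norm_schwartzZT_le (φ : SchwartzZT n) : ∃ b : ℝ, ∀ z, ‖φ.1 z‖ ≤ b := by
  obtain ⟨b, hb⟩ := φ.2.2 0 0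
  exact ⟨b, norm_schwartzZT_le fun m x => by simpa using hb m x⟩

theorem integrable_mul_schwartzZT {u : Zn n × Tn n → ℂ} (hu : Integrable u (haarZT n))
    (φ : SchwartzZT n) : Integrable (fun z => u z * φ.1 z) (haarZT n) := by
  obtain ⟨b, hb⟩ := exists_norm_schwartzZT_le φ
  exact hu.mul_bdd (c := b) (measurable_schwartzZT φ).aestronglyMeasurable
    (Filter.Eventually.of_forall hb)

/-- The distribution given by an integrable function. -/
def regularZT (u : Zn n × Tn n → ℂ) (hu : Integrable u (haarZT n)) : SchwartzZT n →ₗ[ℂ] ℂ where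
  toFun φ := ∫ z, u z * φ.1 z ∂haarZT n
  map_add' φ ψ := by
    rw [← integral_add (integrable_mul_schwartzZT hu φ) (integrable_mul_schwartzZT hu ψ)]
    exact integral_congr_ae (Filter.Eventually.of_forall fun z => mul_add _ _ _)
  map_smul' a φ := by
    rw [RingHom.id_apply, smul_eq_mul, ← integral_const_mul]
    exact integral_congr_ae (Filter.Eventually.of_forall fun z => mul_left_comm _ _ _)

theorem isRegular_regularZT {u : Zn n × Tn n → ℂ} (hu : Integrable u (haarZT n)) :
    IsRegular (regularZT u hu) u := ⟨hu, fun _ => rfl⟩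

theorem isTemperedZT_regularZT {u : Zn n × Tn n → ℂ} (hu : Integrable u (haarZT n)) :
    IsTemperedZT (regularZT u hu) := by
  refine ⟨0, ∫ z, ‖u z‖ ∂haarZT n, fun φ b h => ?_⟩
  have hb : ∀ z, ‖φ.1 z‖ ≤ b := norm_schwartzZT_le fun m x => by
    simpa using h 0 le_rfl 0 le_rfl m x
  rw [← integral_mul_const]
  refine norm_integral_le_of_norm_le (hu.norm.mul_const b)
    (Filter.Eventually.of_forall fun z => ?_)
  rw [norm_mul]
  exact mul_le_mul_of_nonneg_left (hb z) (norm_nonneg _)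

/-- Distributions act bilinearly, without conjugation; the sign in `coeffZT` is what makes it the
usual Fourier coefficient. -/
theorem coeffZT_of_isRegular {τ : SchwartzZT n →ₗ[ℂ] ℂ} {u : Zn n × Tn n → ℂ}
    (h : IsRegular τ u) (m j : Zn n) :
    coeffZT τ (m, j) = ∫ w, u (m, w) * chr (-j) w ∂haarT n := by
  have hint : Integrable (fun z => u z * (tensorZT m (-j)).1 z) (Measure.count.prod (haarT n)) :=
    integrable_mul_schwartzZT h.1 (tensorZT m (-j))
  rw [coeffZT, h.2, haarZT, integral_prod _ hint, integral_countable hint.integral_prod_left,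
    tsum_eq_single m]
  · simp [tensorZT_apply]
  · intro k hk
    simp [tensorZT_apply, hk]

/-- The function with given summable Fourier coefficients. -/
def fourierSeries (c : Zn n × Zn n → ℂ) (z : Zn n × Tn n) : ℂ := ∑' j, c (z.1, j) * chr j z.2

theorem summable_row {c : Zn n × Zn n → ℂ} (hc : Summable fun q => ‖c q‖) (m : Zn n) :
    Summable fun j => ‖c (m, j)‖ :=
  hc.comp_injective (i := fun j : Zn n => (m, j)) fun _ _ h => (Prod.ext_iff.1 h).2

theorem integrable_fourierSeries {c : Zn n × Zn n → ℂ} (hc : Summable fun q => ‖c q‖) :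
    Integrable (fourierSeries c) (haarZT n) := by
  have hcont : ∀ m, Continuous fun w : Tn n => ∑' j, c (m, j) * chr j w := fun m =>
    continuous_tsum (f := fun j (w : Tn n) => c (m, j) * chr j w)
      (fun j => continuous_const.mul (continuous_chr j)) (summable_row hc m)
      fun j w => by rw [norm_mul, norm_chr, mul_one]
  have hm : Measurable (fourierSeries c) := measurable_from_prod_countable_right fun m =>
    (hcont m).measurable
  refine ⟨hm.aestronglyMeasurable, ?_⟩
  rw [hasFiniteIntegral_iff_enorm, haarZT, lintegral_prod _ hm.enorm.aemeasurable,
    lintegral_count]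
  have hle : ∀ m, ∫⁻ w, ‖fourierSeries c (m, w)‖ₑ ∂haarT n ≤ ∑' j, ‖c (m, j)‖ₑ := fun m => by
    refine (lintegral_mono (g := fun _ => ∑' j, ‖c (m, j)‖ₑ) fun w => ?_).trans (by simp)
    refine (enorm_tsum_le_tsum_enorm).trans (ENNReal.tsum_le_tsum fun j => ?_)
    rw [enorm_mul, ← ofReal_norm (chr j w), norm_chr, ENNReal.ofReal_one, mul_one]
  refine (ENNReal.tsum_le_tsum hle).trans_lt ?_
  rw [← ENNReal.tsum_prod (f := fun m j => ‖c (m, j)‖ₑ)]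
  exact (tsum_enorm_ne_top_iff_summable_norm.2 hc).lt_top

theorem integral_fourierSeries_mul_chr {c : Zn n × Zn n → ℂ} (hc : Summable fun q => ‖c q‖)
    (m j : Zn n) : ∫ w, fourierSeries c (m, w) * chr (-j) w ∂haarT n = c (m, j) := by
  have h := hasSum_integral_mul_of_summable
    (integrable_of_continuous (Complex.continuous_conj.comp (continuous_chr j)))
    (χ := fun (k : Zn n) (w : Tn n) => chr k w)
    (fun k => (continuous_chr k).aestronglyMeasurable)
    (fun k w => (norm_chr k w).le) (summable_row hc m)
  have h1 : ∀ k, ∫ w, (starRingEnd ℂ ∘ chr j) w * chr k w ∂haarT n =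
      if k = j then 1 else 0 := fun k => by
    have h2 := integral_chr_mul_conj k j
    simp only [mul_comm (chr k _)] at h2
    simpa only [Function.comp_apply, eq_comm] using h2
  simp only [h1, mul_ite, mul_one, mul_zero] at h
  have h2 := h.unique (hasSum_single j fun s hs => if_neg hs)
  rw [if_pos rfl] at h2
  rw [← h2]
  congr 1
  funext w
  rw [chr_neg, mul_comm]
  rfl

theorem coeffZT_regularZT_fourierSeries {c : Zn n × Zn n → ℂ} (hc : Summable fun q => ‖c q‖) :
    coeffZT (regularZT _ (integrable_fourierSeries hc)) = c :=
  funext fun q => (coeffZT_of_isRegular (isRegular_regularZT _) q.1 q.2).trans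
    (integral_fourierSeries_mul_chr hc q.1 q.2)

theorem summable_of_eLpNorm_one_lt_top {α : Type*} [MeasurableSpace α]
    [MeasurableSingletonClass α] {c : α → ℂ} (h : eLpNorm c 1 Measure.count < ⊤) :
    Summable fun a => ‖c a‖ := by
  rw [eLpNorm_one_eq_lintegral_enorm, lintegral_count] at h
  exact tsum_enorm_ne_top_iff_summable_norm.1 h.ne

theorem eLpNorm_count_lt_top_of_summable {α : Type*} [MeasurableSpace α]
    [MeasurableSingletonClass α] [Countable α] {c : α → ℂ} (hc : Summable fun a => ‖c a‖)
    {p : ENNReal} (hp : p = 1 ∨ p = ⊤) : eLpNorm c p Measure.count < ⊤ := by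
  rcases hp with rfl | rfl
  · rw [eLpNorm_one_eq_lintegral_enorm, lintegral_count]
    exact (tsum_enorm_ne_top_iff_summable_norm.2 hc).lt_top
  · refine (memLp_top_of_bound (measurable_of_countable c).aestronglyMeasurable (∑' a, ‖c a‖)
      (Filter.Eventually.of_forall fun a => ?_)).2
    exact hc.le_tsum a fun _ _ => norm_nonneg _

theorem tsum_enorm_fourierZT_lt_top (Φ : SchwartzZT n) : ∑' q, ‖fourierZT Φ q‖ₑ < ⊤ :=
  (tsum_enorm_ne_top_iff_summable_norm.2 (summable_norm_fourierZT Φ)).lt_top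

theorem memModulationZT_of_summable (Φ : SchwartzZT n) {τ : SchwartzZT n →ₗ[ℂ] ℂ}
    (hτ : IsTemperedZT τ) (hc : Summable fun q => ‖coeffZT τ q‖) {p : ENNReal} (hp1 : 1 ≤ p)
    (hp : p = 1 ∨ p = ⊤) : MemModulationZT Φ p τ :=
  ⟨hτ, (hτ.isPhaseSeries_stftZT Φ).measurable.aestronglyMeasurable,
    ((hτ.isPhaseSeries_stftZT Φ).eLpNorm_le hp1).trans_lt
      (ENNReal.mul_lt_top (tsum_enorm_fourierZT_lt_top Φ)
        (eLpNorm_count_lt_top_of_summable hc hp))⟩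

theorem eLpNorm_coeffZT_lt_top {Φ : SchwartzZT n} (hΦ : Φ ≠ 0) {σ : SchwartzZT n →ₗ[ℂ] ℂ}
    {p : ENNReal} (hp1 : 1 ≤ p) (hp : p ≠ ⊤) (hσ : MemModulationZT Φ p σ) :
    eLpNorm (coeffZT σ) p Measure.count < ⊤ := by
  obtain ⟨r, hr⟩ := exists_fourierZT_ne_zero hΦ
  have h := ((hσ.1.isPhaseSeries_stftZT Φ).eLpNorm_coeff_le r hp1 hp).trans_lt hσ.2.2
  rw [ENNReal.mul_lt_top_iff] at h
  rcases h with h | h | h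
  · exact h.2
  · exact absurd (enorm_eq_zero.1 h) hr
  · rw [h]; exact ENNReal.zero_lt_top

theorem norm_coeffZT_le {Φ : SchwartzZT n} (hΦ : Φ ≠ 0) {σ : SchwartzZT n →ₗ[ℂ] ℂ}
    {p : ENNReal} (hp1 : 1 ≤ p) (hp : p ≠ ⊤) (hσ : MemModulationZT Φ p σ) (q : Zn n × Zn n) :
    ‖coeffZT σ q‖ ≤ (eLpNorm (coeffZT σ) p Measure.count).toReal := by
  rw [← toReal_enorm]
  exact ENNReal.toReal_mono (eLpNorm_coeffZT_lt_top hΦ hp1 hp hσ).ne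
    (enorm_le_eLpNorm_count (zero_lt_one.trans_le hp1).ne' hp _ q)

/-- Finite `p` is essential: the error is the tail of the convergent series `∑ |c|ᵖ`. -/
theorem tendsto_eLpNorm_indicator_sub {α : Type*} [MeasurableSpace α]
    [MeasurableSingletonClass α] {p : ENNReal} (hp0 : p ≠ 0) (hp : p ≠ ⊤) {c : α → ℂ}
    (hc : eLpNorm c p Measure.count < ⊤) :
    Filter.Tendsto (fun s : Finset α =>
      eLpNorm ((s : Set α).indicator c - c) p Measure.count) Filter.atTop (nhds 0) := by
  have hpos : 0 < p.toReal := ENNReal.toReal_pos hp0 hp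
  have h1 : ∑' a, ‖c a‖ₑ ^ p.toReal ≠ ⊤ := by
    rw [eLpNorm_lt_top_iff_lintegral_rpow_enorm_lt_top hp0 hp, lintegral_count] at hc
    exact hc.ne
  have h2 := ENNReal.tendsto_tsum_compl_atTop_zero h1
  have h3 := (ENNReal.continuous_rpow_const (y := 1 / p.toReal)).tendsto 0 |>.comp h2
  rw [ENNReal.zero_rpow_of_pos (by positivity)] at h3
  refine h3.congr fun s => ?_
  rw [eLpNorm_eq_lintegral_rpow_enorm_toReal hp0 hp, lintegral_count, Function.comp_apply]
  congr 1
  rw [← tsum_subtype_eq_of_support_subset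
    (f := fun a => ‖((s : Set α).indicator c - c) a‖ₑ ^ p.toReal) (s := {a | a ∉ s})]
  · refine tsum_congr fun a => ?_
    have ha : (a : α) ∉ (s : Set α) := a.2
    simp [Set.indicator_of_notMem ha]
  · intro a ha has
    apply ha
    have : a ∈ (s : Set α) := has
    simp [Set.indicator_of_mem this, hpos]

/-- Distributions in `Mᵖ`, for finite `p`, are limits of distributions with summable Fourier
coefficients. -/
theorem exists_seq_summable_coeffZT {Φ : SchwartzZT n} (hΦ : Φ ≠ 0)
    {σ : SchwartzZT n →ₗ[ℂ] ℂ} {p : ENNReal} (hp1 : 1 ≤ p) (hp : p ≠ ⊤)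
    (hσ : MemModulationZT Φ p σ) :
    ∃ (τ : ℕ → SchwartzZT n →ₗ[ℂ] ℂ) (u : ℕ → Zn n × Tn n → ℂ),
      (∀ i, IsRegular (τ i) (u i) ∧ MemModulationZT Φ 1 (τ i) ∧ MemModulationZT Φ ⊤ (τ i)) ∧
      (∀ i, Summable fun q => ‖coeffZT (τ i) q‖) ∧
      Filter.Tendsto (fun i => modulationNormZT Φ p (τ i - σ)) Filter.atTop (nhds 0) := by
  obtain ⟨s, hs⟩ := Filter.exists_seq_tendsto (Filter.atTop : Filter (Finset (Zn n × Zn n)))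
  -- The approximants keep finitely many Fourier coefficients of `σ`, so they are trigonometric
  -- polynomials on finitely many rows.
  have hsum : ∀ i, Summable fun q => ‖((s i : Set (Zn n × Zn n)).indicator (coeffZT σ)) q‖ :=
    fun i => summable_of_ne_finset_zero (s := s i) fun q hq => by
      rw [Set.indicator_of_notMem (by simpa using hq), norm_zero]
  have hcoeff := fun i => coeffZT_regularZT_fourierSeries (hsum i)
  have htemp := fun i => isTemperedZT_regularZT (integrable_fourierSeries (hsum i))
  have hsum' : ∀ i, Summable fun q =>
      ‖coeffZT (regularZT _ (integrable_fourierSeries (hsum i))) q‖ := fun i => by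
    rw [hcoeff]; exact hsum i
  refine ⟨fun i => regularZT _ (integrable_fourierSeries (hsum i)), fun i => fourierSeries _,
    fun i => ⟨isRegular_regularZT _,
      memModulationZT_of_summable Φ (htemp i) (hsum' i) le_rfl (Or.inl rfl),
      memModulationZT_of_summable Φ (htemp i) (hsum' i) le_top (Or.inr rfl)⟩, hsum', ?_⟩
  have h1 := (tendsto_eLpNorm_indicator_sub (zero_lt_one.trans_le hp1).ne' hp
    (eLpNorm_coeffZT_lt_top hΦ hp1 hp hσ)).comp hs
  have h2 := ENNReal.Tendsto.const_mul h1 (Or.inr (tsum_enorm_fourierZT_lt_top Φ).ne)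
  rw [mul_zero] at h2
  refine tendsto_of_tendsto_of_tendsto_of_le_of_le tendsto_const_nhds h2
    (fun _ => bot_le) fun i => ?_
  have h3 := (((htemp i).sub hσ.1).isPhaseSeries_stftZT Φ).eLpNorm_le hp1
  rw [coeffZT_sub, hcoeff] at h3
  exact h3

end Regular

/-! ### Compactness and trace class -/

section Main

variable {n : ℕ}

/-- The bounded family of Fourier coefficients of a distribution in `Mᵖ` for finite `p`. -/
def bddCoeff {Φ : SchwartzZT n} (hΦ : Φ ≠ 0) {σ : SchwartzZT n →ₗ[ℂ] ℂ} {p : ENNReal}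
    (hp1 : 1 ≤ p) (hp : p ≠ ⊤) (hσ : MemModulationZT Φ p σ) : BddCoeff n :=
  BoundedContinuousFunction.ofNormedAddCommGroupDiscrete (coeffZT σ) _
    (norm_coeffZT_le hΦ hp1 hp hσ)

/-- The sup norm is at most the `ℓᵖ` norm, which is at most `|a(r)|⁻¹` times the `Mᵖ` norm, for any
`r` with `a(r) ≠ 0`. The exponents in the two uses of `bddCoeff` only certify boundedness and do not
affect the family. -/
theorem tendsto_bddCoeff {Φ : SchwartzZT n} (hΦ : Φ ≠ 0) {σ : SchwartzZT n →ₗ[ℂ] ℂ}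
    {p : ENNReal} (hp1 : 1 ≤ p) (hp : p ≠ ⊤) (hσ : MemModulationZT Φ p σ)
    {τ : ℕ → SchwartzZT n →ₗ[ℂ] ℂ} (hτ : ∀ i, MemModulationZT Φ 1 (τ i))
    (h : Filter.Tendsto (fun i => modulationNormZT Φ p (τ i - σ)) Filter.atTop (nhds 0)) :
    Filter.Tendsto (fun i => bddCoeff hΦ le_rfl ENNReal.one_ne_top (hτ i)) Filter.atTop
      (nhds (bddCoeff hΦ hp1 hp hσ)) := by
  obtain ⟨r, hr⟩ := exists_fourierZT_ne_zero hΦ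
  have hr0 : ‖fourierZT Φ r‖ₑ ≠ 0 := enorm_ne_zero.2 hr
  have h1 := ENNReal.Tendsto.const_mul h (a := ‖fourierZT Φ r‖ₑ⁻¹)
    (Or.inr (ENNReal.inv_ne_top.2 hr0))
  rw [mul_zero] at h1
  have h1' := (ENNReal.tendsto_toReal ENNReal.zero_ne_top).comp h1
  rw [tendsto_iff_norm_sub_tendsto_zero]
  refine tendsto_of_tendsto_of_tendsto_of_le_of_le' tendsto_const_nhds h1'
    (Filter.Eventually.of_forall fun _ => norm_nonneg _) ?_
  -- Finiteness is required because `toReal` sends `⊤` to `0`.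
  filter_upwards [h1.eventually_lt_const ENNReal.zero_lt_top] with i hi
  refine (BoundedContinuousFunction.norm_le ENNReal.toReal_nonneg).2 fun q => ?_
  have h2 := (((hτ i).1.sub hσ.1).isPhaseSeries_stftZT Φ).eLpNorm_coeff_le r hp1 hp
  have h3 := enorm_le_eLpNorm_count (zero_lt_one.trans_le hp1).ne' hp (coeffZT (τ i - σ)) q
  have h4 : ‖coeffZT (τ i - σ) q‖ₑ ≤
      ‖fourierZT Φ r‖ₑ⁻¹ * modulationNormZT Φ p (τ i - σ) := by
    refine h3.trans ?_
    rw [mul_comm, ← div_eq_mul_inv, ENNReal.le_div_iff_mul_le (Or.inl hr0)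
      (Or.inl enorm_ne_top), mul_comm]
    exact h2
  have h5 := ENNReal.toReal_mono hi.ne h4
  rwa [toReal_enorm] at h5

theorem isTraceClass_bddCoeff {Φ : SchwartzZT n} (hΦ : Φ ≠ 0) {σ : SchwartzZT n →ₗ[ℂ] ℂ}
    {p : ENNReal} (hp1 : 1 ≤ p) (hp : p ≠ ⊤) (hσ : MemModulationZT Φ p σ) {g₁ g₂ : Zn n → ℂ}
    (h₁ : Summable fun k => ‖g₁ k‖) (h₂ : Summable fun k => ‖g₂ k‖)
    (hsum : Summable fun q => ‖coeffZT σ q‖) :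
    IsTraceClass (coeffLocOp g₁ g₂ (bddCoeff hΦ hp1 hp hσ)) := by
  have hc : ⇑(bddCoeff hΦ hp1 hp hσ) = coeffZT σ := rfl
  exact isTraceClass_coeffLocOp h₁ h₂ (by rwa [hc])

theorem isLocOpFun_bddCoeff {Φ : SchwartzZT n} (hΦ : Φ ≠ 0) {g₁ g₂ : Zn n → ℂ}
    (h₁ : Summable fun k => ‖g₁ k‖) (h₂ : Summable fun k => ‖g₂ k‖)
    {τ : SchwartzZT n →ₗ[ℂ] ℂ} {u : Zn n × Tn n → ℂ} (hu : IsRegular τ u)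
    (hτ : MemModulationZT Φ 1 τ) :
    IsLocOpFun g₁ g₂ u (coeffLocOp g₁ g₂ (bddCoeff hΦ le_rfl ENNReal.one_ne_top hτ)) :=
  isLocOpFun_coeffLocOp h₁ h₂ hu.1 fun m j => coeffZT_of_isRegular hu m j

end Main

end

end DiscreteLoc

/-! ### Proof of the theorem. -/

theorem mainTheorem2 (n : ℕ)
    (φ : Zn n → ℂ) (hφ : IsSchwartzZ φ) (hφ0 : φ ≠ 0)
    (Φ : SchwartzZT n) (hΦ0 : Φ ≠ 0)
    (p : ENNReal) (hp1 : 1 ≤ p) (hp : p < ⊤)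
    (σ : SchwartzZT n →ₗ[ℂ] ℂ) (hσ : MemModulationZT Φ p σ)
    (g₁ g₂ : Zn n → ℂ) (hg₁ : MemModulationZ φ 1 g₁) (hg₂ : MemModulationZ φ 1 g₂) :
    ∃ A : ell2 n →L[ℂ] ell2 n,
      (∀ A', IsLocOp Φ p g₁ g₂ σ A' ↔ A' = A) ∧
      IsCompactOperator A ∧
      (MemModulationZT Φ 1 σ → IsTraceClass A) := by
  have h₁ := summable_of_memModulationZ hφ hφ0 hg₁
  have h₂ := summable_of_memModulationZ hφ hφ0 hg₂
  obtain ⟨τ, u, hreg, hsum, hlim⟩ := exists_seq_summable_coeffZT hΦ0 hp1 hp.ne hσ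
  have hconv : ∀ τ : ℕ → SchwartzZT n →ₗ[ℂ] ℂ, ∀ hτ : ∀ i, MemModulationZT Φ 1 (τ i),
      Filter.Tendsto (fun i => modulationNormZT Φ p (τ i - σ)) Filter.atTop (nhds 0) →
      Filter.Tendsto (fun i => coeffLocOp g₁ g₂
        (bddCoeff hΦ0 le_rfl ENNReal.one_ne_top (hτ i))) Filter.atTop
          (nhds (coeffLocOp g₁ g₂ (bddCoeff hΦ0 hp1 hp.ne hσ))) := fun τ hτ h =>
    tendsto_coeffLocOp h₁ h₂ (tendsto_bddCoeff hΦ0 hp1 hp.ne hσ hτ h)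
  have hA : IsLocOp Φ p g₁ g₂ σ (coeffLocOp g₁ g₂ (bddCoeff hΦ0 hp1 hp.ne hσ)) := by
    refine ⟨⟨u, τ, hreg, hlim⟩, fun u' hu' => ?_⟩
    obtain ⟨τ', hreg', hlim'⟩ := hu'
    exact ⟨_, fun i => isLocOpFun_bddCoeff hΦ0 h₁ h₂ (hreg' i).1 (hreg' i).2.1,
      hconv τ' (fun i => (hreg' i).2.1) hlim'⟩
  refine ⟨coeffLocOp g₁ g₂ (bddCoeff hΦ0 hp1 hp.ne hσ), fun A' => ⟨fun hA' => ?_, ?_⟩, ?_, ?_⟩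
  -- Along the truncation sequence the defining formula determines each operator, so two candidates
  -- are limits of the same sequence.
  · obtain ⟨B, hB, hBlim⟩ := hA.2 u ⟨τ, hreg, hlim⟩
    obtain ⟨B', hB', hBlim'⟩ := hA'.2 u ⟨τ, hreg, hlim⟩
    have hBB : B' = B := funext fun i => (hB' i).unique (hB i)
    rw [hBB] at hBlim'
    exact tendsto_nhds_unique hBlim' hBlim
  · rintro rfl
    exact hA
  -- The truncated symbols give trace class, in particular compact, operators.
  · exact isCompactOperator_of_tendsto (hconv τ (fun i => (hreg i).2.1) hlim)
      (Filter.Eventually.of_forall fun i =>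
        (isTraceClass_bddCoeff hΦ0 le_rfl ENNReal.one_ne_top (hreg i).2.1 h₁ h₂ (hsum i)).1)
  · intro h1
    -- Membership in `M¹` makes the same coefficients summable, so the operator built with exponent
    -- `p` is itself nuclear, with no approximation.
    exact isTraceClass_bddCoeff hΦ0 hp1 hp.ne hσ h₁ h₂ (summable_of_eLpNorm_one_lt_top
      (eLpNorm_coeffZT_lt_top hΦ0 le_rfl ENNReal.one_ne_top h1))
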